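/- **Notation.** For $n\in\mathbb{Z}$ put $[n]_q=\frac{1-q^n}{1-q}\in\mathbb{Q}(q)$. Let $\mathcal{R}_q$ be the ring of quantum integer-valued polynomials, i.e. of all $f(t;q)\in\mathbb{Q}(q)[t]$ with $f([n]_q;q)\in\mathbb{Z}[q,q^{-1}]$ for all $n\in\mathbb{Z}$, and let $\mathcal{R}_q^+$ be the set of $f\in\mathcal{R}_q$ with $f([n]_q;q)\in\mathbb{Z}[q]$ for all positive integers $n$. The bar involution $f\mapsto\overline{f}$ of $\mathbb{Q}(q)[t]$ is the ring automorphism with $q\mapsto q^{-1}$, $t\mapsto -qt$; and $f([n]_q;q^{-1})$ denotes the image of $f([n]_q;q)\in\mathbb{Q}(q)$ under $q\mapsto q^{-1}$. For a finite set $\mathcal{Z}\subseteq\mathbb{C}^d$ let $I(\mathcal{Z})\subseteq\mathbb{C}[x_1,\dots,x_d]$ be its vanishing ideal, let $\operatorname{gr}I(\mathcal{Z})$ be the ideal generated by the top degree homogeneous components of the elements of $I(\mathcal{Z})$, and let $\operatorname{Orb}(\mathcal{Z})=\mathbb{C}[x_1,\dots,x_d]/\operatorname{gr}I(\mathcal{Z})$,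 graded by degree. For a lattice polytope $P\subseteq\mathbb{R}^d$ and an integer $m\ge 0$ put $$i_P(m;q)=\sum_{k\ge0}\dim_{\mathbb{C}}\operatorname{Orb}(mP\cap\mathbb{Z}^d)_k\,q^k,\qquad \widetilde{i_P}(m;q)=\sum_{k\ge0}\dim_{\mathbb{C}}\operatorname{Orb}(\operatorname{int}(mP)\cap\mathbb{Z}^d)_k\,q^k .$$ **Proposition.** Let $A$ be a $d\times n$ integer matrix of full rank $d$ all of whose maximal minors lie in $\{-1,0,1\}$, and let $Z=A\cdot[0,1]^n\subseteq\mathbb{R}^d$ be the corresponding unimodular zonotope. There is a quantum integer-valued polynomial $\mathrm{ehr}_Z(t;q)\in\mathcal{R}_q^+$, whose $t$-degree is the number of nonzero columns of $A$ (so it is $n$ if $A$ has no zero column), such that $$\mathrm{ehr}_Z([m]_q;q)=i_Z(m;q)\qquad\text{for all integers } m\ge0,$$ and such that, for all integers $m\ge1$, $$(-1)^dq^{-d}\,\overline{\mathrm{ehr}_Z}([m]_q;q)=(-1)^dq^{-d}\,\mathrm{ehr}_Z([-m]_q;q^{-1})=\widetilde{i_Z}(m;q).$$ -/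

import Mathlib

open scoped Pointwise

noncomputable section

namespace GradedEhrhart

/-! ### Quantum integer-valued polynomials -/

/-- The variable `q` of the field `ℚ(q)`. -/
abbrev q : RatFunc ℚ := RatFunc.X

/-- The `q`-number `[n]_q = (1 - q ^ n) / (1 - q)` of an integer `n`. -/
def qInt (n : ℤ) : RatFunc ℚ := (1 - q ^ n) / (1 - q)

/-- The subring `ℤ[q]` of `ℚ(q)`. -/
def intPoly : Subalgebra ℤ (RatFunc ℚ) := Algebra.adjoin ℤ {q}

/-- The subring `ℤ[q, q⁻¹]` of `ℚ(q)`. -/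
def intLaurent : Subalgebra ℤ (RatFunc ℚ) := Algebra.adjoin ℤ {q, q⁻¹}

/-- `f ∈ ℚ(q)[t]` belongs to the ring `R_q` of quantum integer-valued polynomials. -/
def IsQuantumIntegerValued (f : Polynomial (RatFunc ℚ)) : Prop :=
  ∀ n : ℤ, f.eval (qInt n) ∈ intLaurent

/-- `f ∈ ℚ(q)[t]` belongs to the positive part `R_q^+` of `R_q`. -/
def IsPositiveQuantumIntegerValued (f : Polynomial (RatFunc ℚ)) : Prop :=
  IsQuantumIntegerValued f ∧ ∀ n : ℤ, 0 < n → f.eval (qInt n) ∈ intPoly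

/-- The substitution `q ↦ q⁻¹` on polynomials in `q`. -/
def substInv (K : Type) [Field K] : Polynomial K →+* RatFunc K :=
  Polynomial.eval₂RingHom RatFunc.C (RatFunc.X : RatFunc K)⁻¹

theorem substInv_injective (K : Type) [Field K] : Function.Injective (substInv K) := by
  have h : Transcendental K (RatFunc.X : RatFunc K)⁻¹ := fun h =>
    RatFunc.transcendental_X (K := K) (by simpa using h.inv)
  exact transcendental_iff_injective.mp h

/-- The field automorphism `q ↦ q⁻¹` of `ℚ(q)`. -/
def invertQ : RatFunc ℚ →+* RatFunc ℚ :=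
  RatFunc.liftRingHom (substInv ℚ)
    (nonZeroDivisors_le_comap_nonZeroDivisors_of_injective _ (substInv_injective ℚ))

/-- The bar involution of `ℚ(q)[t]`, which sends `q ↦ q⁻¹` and `t ↦ -q t`. -/
def bar (f : Polynomial (RatFunc ℚ)) : Polynomial (RatFunc ℚ) :=
  (f.map invertQ).comp (-(Polynomial.C q * Polynomial.X))

/-! ### Orbit harmonics -/

/-- For an ideal `I`, the ideal `gr I` generated by the top degree homogeneous components of the
elements of `I`. -/
def gr {d : ℕ} (I : Ideal (MvPolynomial (Fin d) ℂ)) : Ideal (MvPolynomial (Fin d) ℂ) :=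
  Ideal.span {g | ∃ f ∈ I, g = MvPolynomial.homogeneousComponent f.totalDegree f}

/-- The orbit harmonics ring `Orb(𝒵) = ℂ[x₁, …, x_d] / gr I(𝒵)` of a point locus `𝒵`. -/
abbrev Orb {d : ℕ} (𝒵 : Set (Fin d → ℂ)) : Type :=
  MvPolynomial (Fin d) ℂ ⧸ gr (MvPolynomial.vanishingIdeal ℂ 𝒵)

/-- The graded piece of degree `k` of `Orb(𝒵)`: the classes of the homogeneous polynomials of
degree `k`. -/
def orbPiece {d : ℕ} (𝒵 : Set (Fin d → ℂ)) (k : ℕ) : Submodule ℂ (Orb 𝒵) :=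
  (MvPolynomial.homogeneousSubmodule (Fin d) ℂ k).map
    (Ideal.Quotient.mkₐ ℂ (gr (MvPolynomial.vanishingIdeal ℂ 𝒵))).toLinearMap

/-- The Hilbert series `∑ₖ dim_ℂ (Orb(𝒵)ₖ) qᵏ`. -/
def hilbOrb {d : ℕ} (𝒵 : Set (Fin d → ℂ)) : PowerSeries ℚ :=
  PowerSeries.mk fun k => (Module.finrank ℂ (orbPiece 𝒵 k) : ℚ)

/-- The lattice points of `S ⊆ ℝ^d`, as a point locus in `ℂ^d`. -/
def latticePoints {d : ℕ} (S : Set (Fin d → ℝ)) : Set (Fin d → ℂ) :=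
  (fun (z : Fin d → ℤ) (i : Fin d) => (z i : ℂ)) '' {z | (fun i => (z i : ℝ)) ∈ S}

/-- The graded lattice point count `i_P(m; q)`. -/
def latticeCount {d : ℕ} (P : Set (Fin d → ℝ)) (m : ℕ) : PowerSeries ℚ :=
  hilbOrb (latticePoints ((m : ℝ) • P))

/-- The graded interior lattice point count `ĩ_P(m; q)`. -/
def interiorLatticeCount {d : ℕ} (P : Set (Fin d → ℝ)) (m : ℕ) : PowerSeries ℚ :=
  hilbOrb (latticePoints (interior ((m : ℝ) • P)))

/-! ### Unimodular zonotopes -/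

/-- A `d × n` integer matrix is unimodular if it has full rank `d` and all its maximal minors lie
in `{-1, 0, 1}`. -/
def IsUnimodular {d n : ℕ} (A : Matrix (Fin d) (Fin n) ℤ) : Prop :=
  (A.map (Int.cast : ℤ → ℝ)).rank = d ∧
    ∀ e : Fin d ↪o Fin n, (A.submatrix id e).det ∈ ({-1, 0, 1} : Set ℤ)

/-- The zonotope `A · [0,1]ⁿ ⊆ ℝ^d`. -/
def zonotope {d n : ℕ} (A : Matrix (Fin d) (Fin n) ℤ) : Set (Fin d → ℝ) :=
  (A.map (Int.cast : ℤ → ℝ)).mulVec '' Set.Icc 0 1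

end GradedEhrhart

end

noncomputable section

namespace GradedEhrhart

open Polynomial

/-! ### Linear forms attached to integer vectors -/

/-! The proof runs by deletion and contraction, with an upper and a lower bound that meet. Dilating
the zonotope by m amounts to repeating each column m times, so lists of vectors suffice. `graded` is
the candidate Hilbert polynomial: deletion carries the factor q, contraction the factor 1, and
contractions are recorded by intersecting a subspace `E` with hyperplanes.

Upper bound. By Macaulay duality the dual of the degree k piece of Orb is a space of homogeneous
polynomial functions of degree k (`finrank_orbPiece_le`). Let η be an integer vector whose pairings
with the columns are -1, 0 or 1, exactly w entries of the list pairing nontrivially. The linear form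
η takes at most w + 1 values on the lattice points and, if w > 0, at most w - 1 on the interior
ones. The corresponding power of η lies in gr I, which bounds the degree of the dual functions along
η. Restricting such functions to a hyperplane a = 0, with kernel the multiples of a, turns the
recursion into an inequality of dimensions (`finrank_boundedFun_le`). The condition on the minors
ensures, through Cramer's rule, that there are enough directions η (`perp_le_span_testDirs`).

Lower bound. The numbers of points satisfy the recursion at q = 1 as an inequality in the opposite
sense (`eval_graded_le_encard_points`), and by interpolation they are at most the total dimension of
Orb. Hence all inequalities are equalities (`finrank_orbPiece_eq`).

Ehrhart polynomial and reciprocity. In a deletion-contraction sum, m copies of a vector act like one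
vector with weights q^m and [m], that is 1 - (1 - q)t and t at t = [m]; this dictates `ehrhart`.
Under q ↦ 1/q the number [-m] becomes -q[m]. Moving the factor -q out of the contraction weight
leaves values (-q)^(-dim E) at the ends of the recursion. With these values, deletion and
contraction cancel whenever the deleted vector is a coloop, because q(-q)⁻¹ + 1 = 0, and this is the
recursion for interior points (`map_graded_true`). -/

/-- The standard pairing on `ℝ^d`, as a map to the dual space. -/
def form {d : ℕ} : (Fin d → ℝ) →ₗ[ℝ] Module.Dual ℝ (Fin d → ℝ) := dotProductBilin ℝ ℝ

theorem form_apply {d : ℕ} (x y : Fin d → ℝ) : form x y = ∑ i, x i * y i := rfl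

/-- An integer vector as a real vector. -/
def intVec {d : ℕ} (a : Fin d → ℤ) : Fin d → ℝ := fun i => (a i : ℝ)

/-- The hyperplane orthogonal to an integer vector. -/
def hyp {d : ℕ} (a : Fin d → ℤ) : Submodule ℝ (Fin d → ℝ) := LinearMap.ker (form (intVec a))

theorem mem_hyp {d : ℕ} {a : Fin d → ℤ} {y : Fin d → ℝ} : y ∈ hyp a ↔ form (intVec a) y = 0 :=
  LinearMap.mem_ker

/-- The common orthogonal complement of a list of integer vectors. -/
def perp {d : ℕ} : List (Fin d → ℤ) → Submodule ℝ (Fin d → ℝ)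
  | [] => ⊤
  | a :: L => hyp a ⊓ perp L

theorem mem_perp {d : ℕ} {L : List (Fin d → ℤ)} {y : Fin d → ℝ} :
    y ∈ perp L ↔ ∀ a ∈ L, form (intVec a) y = 0 := by
  induction L with
  | nil => simp [perp]
  | cons a L ih => simp [perp, ih, mem_hyp]

theorem perp_append {d : ℕ} (L M : List (Fin d → ℤ)) : perp (L ++ M) = perp L ⊓ perp M := by
  ext y
  simp only [mem_perp, Submodule.mem_inf, List.mem_append]
  constructor
  · exact fun h => ⟨fun a ha => h a (Or.inl ha), fun a ha => h a (Or.inr ha)⟩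
  · rintro ⟨h1, h2⟩ a (ha | ha)
    exacts [h1 a ha, h2 a ha]

theorem finrank_hyp_inf {d : ℕ} {a : Fin d → ℤ} {E : Submodule ℝ (Fin d → ℝ)} (h : ¬ E ≤ hyp a) :
    Module.finrank ℝ E = Module.finrank ℝ ↥(hyp a ⊓ E) + 1 := by
  have h1 := LinearMap.finrank_range_add_finrank_ker ((form (intVec a)).domRestrict E)
  have h2 : LinearMap.range ((form (intVec a)).domRestrict E) = ⊤ := by
    apply LinearMap.range_eq_top.mpr
    apply LinearMap.surjective
    intro h0
    apply h
    intro y hy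
    have := LinearMap.congr_fun h0 ⟨y, hy⟩
    exact mem_hyp.mpr (by simpa using this)
  have h3 : Module.finrank ℝ (LinearMap.ker ((form (intVec a)).domRestrict E)) =
      Module.finrank ℝ ↥(hyp a ⊓ E) := by
    have hr : LinearMap.range (E.subtype.domRestrict
        (Submodule.comap E.subtype (LinearMap.ker (form (intVec a))))) = hyp a ⊓ E := by
      ext y
      simp only [LinearMap.mem_range, Submodule.mem_inf]
      constructor
      · rintro ⟨⟨⟨x, hx⟩, hx'⟩, rfl⟩
        exact ⟨by simpa [mem_hyp] using hx', hx⟩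
      · rintro ⟨h1, h2⟩
        exact ⟨⟨⟨y, h2⟩, by simpa [mem_hyp] using h1⟩, rfl⟩
    rw [LinearMap.ker_domRestrict, ← LinearMap.finrank_range_of_inj (f := E.subtype.domRestrict _)
      (fun x y hxy => by
        apply Subtype.ext; apply Subtype.ext; simpa using hxy), hr]
  rw [h2, h3, finrank_top, Module.finrank_self] at h1
  omega

/-! ### Deletion-contraction sums -/

open Classical in
/-- The deletion-contraction sum of a list of vectors, restricted to the subspace `E`, with weight
`s` for a deletion, weight `t` for a contraction and values `c` on subspaces. -/
def delCon {d : ℕ} {K : Type} [CommSemiring K] (s t : K) (c : Submodule ℝ (Fin d → ℝ) → K) :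
    List (Fin d → ℤ) → Submodule ℝ (Fin d → ℝ) → K
  | [], E => c E
  | a :: L, E => if E ≤ hyp a then delCon s t c L E
      else s * delCon s t c L E + t * delCon s t c L (hyp a ⊓ E)

section DelCon

variable {d : ℕ} {K : Type} [CommSemiring K] (s t : K) (c : Submodule ℝ (Fin d → ℝ) → K)

theorem delCon_cons_of_le {a : Fin d → ℤ} {L : List (Fin d → ℤ)} {E : Submodule ℝ (Fin d → ℝ)}
    (h : E ≤ hyp a) : delCon s t c (a :: L) E = delCon s t c L E := by
  simp [delCon, h]

theorem delCon_cons_of_not_le {a : Fin d → ℤ} {L : List (Fin d → ℤ)}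
    {E : Submodule ℝ (Fin d → ℝ)} (h : ¬ E ≤ hyp a) : delCon s t c (a :: L) E =
      s * delCon s t c L E + t * delCon s t c L (hyp a ⊓ E) := by
  simp [delCon, h]

theorem map_delCon {K' : Type} [CommSemiring K'] (φ : K →+* K') (L : List (Fin d → ℤ))
    (E : Submodule ℝ (Fin d → ℝ)) :
    φ (delCon s t c L E) = delCon (φ s) (φ t) (fun E => φ (c E)) L E := by
  induction L generalizing E with
  | nil => rfl
  | cons a L ih =>
    by_cases h : E ≤ hyp a
    · rw [delCon_cons_of_le _ _ _ h, delCon_cons_of_le _ _ _ h, ih]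
    · rw [delCon_cons_of_not_le _ _ _ h, delCon_cons_of_not_le _ _ _ h, map_add, map_mul, map_mul,
        ih, ih]

theorem delCon_replicate_of_le {a : Fin d → ℤ} {L : List (Fin d → ℤ)}
    {E : Submodule ℝ (Fin d → ℝ)} (h : E ≤ hyp a) (m : ℕ) :
    delCon s t c (List.replicate m a ++ L) E = delCon s t c L E := by
  induction m with
  | zero => rfl
  | succ m ih => rw [List.replicate_succ, List.cons_append, delCon_cons_of_le _ _ _ h, ih]

/-- Once one copy of a is contracted, the remaining copies vanish on the subspace and drop out. The
sum therefore runs over the number i of copies deleted before the first contraction. -/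
theorem delCon_replicate_of_not_le {a : Fin d → ℤ} {L : List (Fin d → ℤ)}
    {E : Submodule ℝ (Fin d → ℝ)} (h : ¬ E ≤ hyp a) (m : ℕ) :
    delCon s 1 c (List.replicate m a ++ L) E =
      s ^ m * delCon s 1 c L E + (∑ i ∈ Finset.range m, s ^ i) * delCon s 1 c L (hyp a ⊓ E) := by
  induction m with
  | zero => simp
  | succ m ih =>
    rw [List.replicate_succ, List.cons_append, delCon_cons_of_not_le _ _ _ h, ih,
      delCon_replicate_of_le _ _ _ inf_le_left, Finset.sum_range_succ', pow_zero, one_mul,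
      add_mul, one_mul, mul_add, pow_succ', Finset.sum_mul, Finset.mul_sum, Finset.sum_mul]
    rw [← add_assoc]
    congr 2
    · ring
    · exact Finset.sum_congr rfl fun i _ => by ring

theorem delCon_flatMap_replicate (L : List (Fin d → ℤ)) (E : Submodule ℝ (Fin d → ℝ)) (m : ℕ) :
    delCon s 1 c (L.flatMap (List.replicate m)) E =
      delCon (s ^ m) (∑ i ∈ Finset.range m, s ^ i) c L E := by
  induction L generalizing E with
  | nil => rfl
  | cons a L ih =>
    rw [List.flatMap_cons]
    by_cases h : E ≤ hyp a
    · rw [delCon_replicate_of_le _ _ _ h, delCon_cons_of_le _ _ _ h, ih]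
    · rw [delCon_replicate_of_not_le _ _ h, delCon_cons_of_not_le _ _ _ h, ih, ih]

end DelCon

/-- Each contraction lowers dim E by exactly one, so a factor l per contraction can be read off from
the dimension of the subspace at which the recursion ends. -/
theorem delCon_scale {d : ℕ} {K : Type} [Field K] (s t l : K) (hl : l ≠ 0)
    (L : List (Fin d → ℤ)) (E : Submodule ℝ (Fin d → ℝ)) :
    l⁻¹ ^ Module.finrank ℝ E * delCon s (l * t) (fun _ => 1) L E =
      delCon s t (fun E => l⁻¹ ^ Module.finrank ℝ E) L E := by
  induction L generalizing E with
  | nil => simp [delCon]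
  | cons a L ih =>
    by_cases h : E ≤ hyp a
    · rw [delCon_cons_of_le _ _ _ h, delCon_cons_of_le _ _ _ h, ih]
    · rw [delCon_cons_of_not_le _ _ _ h, delCon_cons_of_not_le _ _ _ h, ← ih, ← ih,
        finrank_hyp_inf h, pow_succ]
      linear_combination (t * delCon s (l * t) (fun _ => 1) L (hyp a ⊓ E) *
        l⁻¹ ^ Module.finrank ℝ ↥(hyp a ⊓ E)) * inv_mul_cancel₀ hl

/-- A vector that is not in the span of the others contributes a scalar factor. -/
theorem delCon_of_coloop {d : ℕ} {K : Type} [CommSemiring K] (s t u : K)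
    (c : Submodule ℝ (Fin d → ℝ) → K) {a : Fin d → ℤ}
    (hc : ∀ E : Submodule ℝ (Fin d → ℝ), ¬ E ≤ hyp a → c E = u * c (hyp a ⊓ E))
    (L : List (Fin d → ℤ)) (E : Submodule ℝ (Fin d → ℝ)) {η : Fin d → ℝ} (hE : η ∈ E)
    (hL : η ∈ perp L) (ha : η ∉ hyp a) :
    delCon s t c L E = u * delCon s t c L (hyp a ⊓ E) := by
  induction L generalizing E with
  | nil => exact hc E fun h => ha (h hE)
  | cons b L ih =>
    have hb : η ∈ hyp b := hL.1
    by_cases h : E ≤ hyp b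
    · rw [delCon_cons_of_le _ _ _ h, delCon_cons_of_le _ _ _ (inf_le_right.trans h), ih E hE hL.2]
    -- Subtracting a multiple of η moves any y of E into the hyperplane of a without changing its
    -- pairing with b. Hence b is nonzero on E exactly when it is nonzero on the contraction, and
    -- the two recursions stay parallel.
    · have h' : ¬ hyp a ⊓ E ≤ hyp b := by
        intro h'
        apply h
        intro y hy
        rw [mem_hyp] at ha
        have hz : y - (form (intVec a) y / form (intVec a) η) • η ∈ hyp b := by
          apply h'
          refine ⟨?_, E.sub_mem hy (E.smul_mem _ hE)⟩
          simp [mem_hyp, ha]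
        rw [mem_hyp] at hz hb ⊢
        simpa [hb] using hz
      rw [delCon_cons_of_not_le _ _ _ h, delCon_cons_of_not_le _ _ _ h', ih E hE hL.2,
        ih (hyp b ⊓ E) ⟨hb, hE⟩ hL.2, inf_left_comm]
      ring

/-! ### Graded counts for closed and open zonotopes -/

open Classical in
/-- The polynomial with natural number coefficients which is the graded lattice point count of a
unimodular zonotope (if `b` is false), or the graded interior lattice point count (if `b` is
true). -/
def graded {d : ℕ} (b : Bool) : List (Fin d → ℤ) → Submodule ℝ (Fin d → ℝ) → ℕ[X]
  | [], _ => 1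
  | a :: L, E => if E ≤ hyp a then graded b L E
      else if b = true ∧ E ⊓ perp L ≠ ⊥ then 0
      else X * graded b L E + graded b L (hyp a ⊓ E)

theorem graded_false {d : ℕ} (L : List (Fin d → ℤ)) (E : Submodule ℝ (Fin d → ℝ)) :
    graded false L E = delCon X 1 (fun _ => 1) L E := by
  induction L generalizing E with
  | nil => rfl
  | cons a L ih => by_cases h : E ≤ hyp a <;> simp [graded, delCon, h, ih]

/-- The zero branch of `graded true` comes from the values (-q)^(-dim E): at a coloop they make the
deletion and contraction terms cancel. -/
theorem map_graded_true {d : ℕ} {K : Type} [Field K] (φ : ℕ[X] →+* K) (hφ : φ X ≠ 0)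
    (L : List (Fin d → ℤ)) (E : Submodule ℝ (Fin d → ℝ)) (hE : E ⊓ perp L = ⊥) :
    φ (graded true L E) = delCon (φ X) 1 (fun E => (-φ X)⁻¹ ^ Module.finrank ℝ E) L E := by
  induction L generalizing E with
  | nil =>
    have : E = ⊥ := by simpa [perp] using hE
    subst this
    simp [graded, delCon]
  | cons a L ih =>
    by_cases h : E ≤ hyp a
    · have hE' : E ⊓ perp L = ⊥ := by
        rw [← hE, perp, ← inf_assoc, inf_eq_left.mpr h]
      rw [delCon_cons_of_le _ _ _ h, ← ih E hE']
      simp [graded, h]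
    · have hE' : hyp a ⊓ E ⊓ perp L = ⊥ := by
        rw [← hE, perp, inf_left_comm, inf_assoc]
      rw [delCon_cons_of_not_le _ _ _ h, ← ih _ hE']
      by_cases h2 : E ⊓ perp L = ⊥
      · rw [← ih E h2]
        simp [graded, h, h2]
      -- A nonzero η in E orthogonal to L cannot be orthogonal to a, so a is a coloop, and the
      -- deletion term is minus the contraction term.
      · obtain ⟨η, hη, hη0⟩ := Submodule.exists_mem_ne_zero_of_ne_bot h2
        have hηa : η ∉ hyp a := fun h0 => hη0 (by
          have : η ∈ hyp a ⊓ E ⊓ perp L := ⟨⟨h0, hη.1⟩, hη.2⟩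
          rwa [hE', Submodule.mem_bot] at this)
        rw [delCon_of_coloop (φ X) 1 (-φ X)⁻¹ _ (fun E hE => by rw [finrank_hyp_inf hE, pow_succ'])
          L E hη.1 hη.2 hηa, ih _ hE']
        have h3 : φ X * (-φ X)⁻¹ = -1 := by rw [inv_neg, mul_neg, mul_inv_cancel₀ hφ]
        rw [← mul_assoc, h3]
        simp [graded, h, h2]

end GradedEhrhart

end

noncomputable section

namespace GradedEhrhart

/-! ### Test directions of a unimodular matrix -/

theorem form_intVec {d : ℕ} (a k : Fin d → ℤ) :
    form (intVec a) (intVec k) = ((a ⬝ᵥ k : ℤ) : ℝ) := by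
  simp [form_apply, intVec, dotProduct]

/-- The integer vectors whose pairings with the columns of `A` are `-1`, `0` or `1`. -/
def testDirs {d n : ℕ} (A : Matrix (Fin d) (Fin n) ℤ) : Set (Fin d → ℝ) :=
  {η | ∃ k : Fin d → ℤ, intVec k = η ∧ ∀ j, A.col j ⬝ᵥ k ∈ ({-1, 0, 1} : Set ℤ)}

/-- Sorting the chosen columns changes the determinant only by a sign, and a repeated column makes
it zero. -/
theorem det_submatrix_mem {d n : ℕ} {A : Matrix (Fin d) (Fin n) ℤ}
    (hA : ∀ e : Fin d ↪o Fin n, (A.submatrix id e).det ∈ ({-1, 0, 1} : Set ℤ))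
    (f : Fin d → Fin n) : (A.submatrix id f).det ∈ ({-1, 0, 1} : Set ℤ) := by
  by_cases hf : Function.Injective f
  · have hm : StrictMono (f ∘ Tuple.sort f) :=
      (Tuple.monotone_sort f).strictMono_of_injective (hf.comp (Tuple.sort f).injective)
    have h := hA (OrderEmbedding.ofStrictMono _ hm)
    have h2 : A.submatrix id (OrderEmbedding.ofStrictMono _ hm) =
        (A.submatrix id f).submatrix id (Tuple.sort f) := rfl
    rw [h2, Matrix.det_permute'] at h
    rcases Int.units_eq_one_or (Equiv.Perm.sign (Tuple.sort f)) with h1 | h1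
    · simpa [h1] using h
    · simp only [h1, Set.mem_insert_iff, Set.mem_singleton_iff] at h ⊢
      push_cast at h
      omega
  · obtain ⟨i, j, hij, hne⟩ := Function.not_injective_iff.mp hf
    rw [Matrix.det_zero_of_column_eq hne (fun k => by simp [hij])]
    simp

/-- The test directions are the rows of the inverse of a column basis `B` adapted to C: by Cramer's
rule their pairings with the columns are minors up to sign, and those dual to basis vectors outside
the span of C generate the complement of C. -/
theorem perp_le_span_testDirs {d n : ℕ} {A : Matrix (Fin d) (Fin n) ℤ} (hA : IsUnimodular A)
    (C : List (Fin d → ℤ)) (hC : ∀ c ∈ C, ∃ j, c = A.col j) :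
    perp C ≤ Submodule.span ℝ (testDirs A ∩ perp C) := by
  obtain ⟨hrank, hdet⟩ := hA
  set cv : Fin n → Fin d → ℝ := fun j => intVec (A.col j) with hcv
  have hspan : Submodule.span ℝ (Set.range cv) = ⊤ := by
    apply Submodule.eq_top_of_finrank_eq
    rw [Module.finrank_fin_fun]
    rw [Matrix.rank_eq_finrank_span_cols] at hrank
    exact hrank
  -- `b0` indexes a basis of the span of C, chosen among its columns; it is then extended to a basis
  -- `b` of the whole space.
  obtain ⟨b0, hb0s, -, hs0, hb0⟩ := exists_linearIndepOn_extension (v := cv) (K := ℝ)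
    (linearIndepOn_empty ℝ cv) (Set.empty_subset {j | A.col j ∈ C})
  obtain ⟨b, -, hb0b, hbs, hb⟩ := exists_linearIndepOn_extension hb0 (Set.subset_univ b0)
  have htop : ⊤ ≤ Submodule.span ℝ (Set.range fun x : b => cv x) := by
    rw [← hspan, Submodule.span_le, ← Set.image_univ, ← Set.image_eq_range]
    exact hbs
  have : Fintype b := Fintype.ofFinite b
  have hcard : Fintype.card (Fin d) = Nat.card b := by
    rw [Fintype.card_fin, ← Module.finrank_eq_nat_card_basis (Module.Basis.mk hb htop),
      Module.finrank_fin_fun]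
  let e : Fin d ≃ b := Fintype.equivOfCardEq (by rw [hcard, Nat.card_eq_fintype_card])
  let f : Fin d → Fin n := fun i => e i
  have hfinj : Function.Injective f := Subtype.val_injective.comp e.injective
  let B := A.submatrix id f
  have hBdet : B.det ≠ 0 := by
    have hli : LinearIndependent ℝ (fun i => cv (f i)) := hb.comp e e.injective
    have h1 : (B.map (Int.cast : ℤ → ℝ)).det ≠ 0 := by
      have h2 : LinearIndependent ℝ (B.map (Int.cast : ℤ → ℝ)).col := hli
      rw [Matrix.linearIndependent_cols_iff_isUnit, Matrix.isUnit_iff_isUnit_det] at h2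
      exact h2.ne_zero
    intro h0
    apply h1
    have := (Int.castRingHom ℝ).map_det B
    rw [h0] at this
    simpa using this.symm
  have hunit : IsUnit B.det := by
    have := det_submatrix_mem hdet f
    rw [Int.isUnit_iff]
    simp only [Set.mem_insert_iff, Set.mem_singleton_iff] at this
    change B.det = -1 ∨ B.det = 0 ∨ B.det = 1 at this
    tauto
  have hval : ∀ i j, A.col j ⬝ᵥ B⁻¹ i ∈ ({-1, 0, 1} : Set ℤ) := by
    intro i j
    have h1 : A.col j ⬝ᵥ B⁻¹ i = (B⁻¹.mulVec (A.col j)) i := dotProduct_comm _ _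
    have h2 : B.det * (B⁻¹.mulVec (A.col j)) i =
        (A.submatrix id (Function.update f i j)).det := by
      have h3 : A.submatrix id (Function.update f i j) = B.updateCol i (A.col j) := by
        ext r k
        by_cases hk : k = i
        · subst hk; simp
        · simp [hk, B]
      rw [h3, ← Matrix.cramer_apply, ← smul_eq_mul, ← Pi.smul_apply]
      have h4 := Matrix.mulVec_cramer B (A.col j)
      rw [← Matrix.one_mulVec (B.cramer (A.col j)), ← Matrix.nonsing_inv_mul _ hunit,
        ← Matrix.mulVec_mulVec, h4, Matrix.mulVec_smul]
    have h5 := det_submatrix_mem hdet (Function.update f i j)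
    rw [← h2] at h5
    rw [h1]
    rcases Int.isUnit_iff.mp hunit with h6 | h6
    · simpa [h6] using h5
    · simp only [h6, Set.mem_insert_iff, Set.mem_singleton_iff] at h5 ⊢
      omega
  have hdual : ∀ i k, A.col (f i) ⬝ᵥ B⁻¹ k = if k = i then 1 else 0 := by
    intro i k
    have h1 : A.col (f i) ⬝ᵥ B⁻¹ k = (B⁻¹ * B) k i := by
      rw [dotProduct_comm]; rfl
    rw [h1, Matrix.nonsing_inv_mul _ hunit, Matrix.one_apply]
  intro y hy
  have hy' : y = ∑ k, (form (cv (f k)) y) • intVec (B⁻¹ k) := by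
    have h1 : (B.map (Int.cast : ℤ → ℝ)) * (B⁻¹.map (Int.cast : ℤ → ℝ)) = 1 := by
      have h2 := congrArg (fun M => M.map (Int.castRingHom ℝ)) (Matrix.mul_nonsing_inv _ hunit)
      rw [Matrix.map_mul] at h2
      simpa using h2
    have h2 : y = Matrix.vecMul (Matrix.vecMul y (B.map (Int.cast : ℤ → ℝ)))
        (B⁻¹.map (Int.cast : ℤ → ℝ)) := by
      rw [Matrix.vecMul_vecMul, h1, Matrix.vecMul_one]
    rw [Matrix.vecMul_eq_sum] at h2
    refine h2.trans (Finset.sum_congr rfl fun k _ => ?_)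
    congr 1
    exact dotProduct_comm _ _
  rw [hy']
  refine Submodule.sum_mem _ fun k _ => ?_
  -- Coordinates of y along basis columns from C vanish. The remaining dual vectors kill `b0`, hence
  -- all of C.
  by_cases hk : f k ∈ b0
  · rw [mem_perp.mp hy _ (hb0s hk), zero_smul]
    exact Submodule.zero_mem _
  · refine Submodule.smul_mem _ _ (Submodule.subset_span ⟨⟨_, rfl, hval k⟩, ?_⟩)
    refine mem_perp.mpr fun c hc => ?_
    obtain ⟨j, rfl⟩ := hC c hc
    have hj : cv j ∈ Submodule.span ℝ (cv '' b0) := hs0 ⟨j, hc, rfl⟩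
    have hle : Submodule.span ℝ (cv '' b0) ≤
        LinearMap.ker (form.flip (intVec (B⁻¹ k)) : (Fin d → ℝ) →ₗ[ℝ] ℝ) := by
      rw [Submodule.span_le]
      rintro _ ⟨i, hi, rfl⟩
      obtain ⟨l, hl⟩ := e.surjective ⟨i, hb0b hi⟩
      have hl' : f l = i := congrArg Subtype.val hl
      have hne : k ≠ l := fun h => hk (by rw [h, hl']; exact hi)
      simp only [SetLike.mem_coe, LinearMap.mem_ker, LinearMap.flip_apply]
      rw [hcv]
      simp only
      rw [form_intVec, ← hl', hdual, if_neg hne, Int.cast_zero]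
    exact hle hj

end GradedEhrhart

end

noncomputable section

namespace GradedEhrhart

open Polynomial

/-! ### Polynomial functions of bounded degree along test directions -/

/-- The complex valued linear functions on a real vector space, as functions. -/
def linFun {d : ℕ} (E : Submodule ℝ (Fin d → ℝ)) : Submodule ℂ (E → ℂ) where
  carrier := {f | ∃ φ : E →ₗ[ℝ] ℂ, ∀ y, f y = φ y}
  add_mem' := by
    rintro f g ⟨φ, hφ⟩ ⟨ψ, hψ⟩
    exact ⟨φ + ψ, fun y => by simp [hφ, hψ]⟩
  zero_mem' := ⟨0, fun y => rfl⟩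
  smul_mem' := by
    rintro c f ⟨φ, hφ⟩
    exact ⟨c • φ, fun y => by simp [hφ]⟩

section

variable {d : ℕ} (E : Submodule ℝ (Fin d → ℝ))

theorem linFun_fg : (linFun E).FG := by
  have : Module.Finite ℂ (E →ₗ[ℝ] ℂ) := Module.Finite.of_restrictScalars_finite ℝ ℂ _
  let T : (E →ₗ[ℝ] ℂ) →ₗ[ℂ] (E → ℂ) :=
    { toFun := fun φ y => φ y
      map_add' := fun _ _ => rfl
      map_smul' := fun _ _ => rfl }
  have h : linFun E = LinearMap.range T := by
    ext f
    constructor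
    · rintro ⟨φ, hφ⟩
      exact ⟨φ, funext fun y => (hφ y).symm⟩
    · rintro ⟨φ, rfl⟩
      exact ⟨φ, fun y => rfl⟩
  rw [h]
  exact (Module.Finite.iff_fg).mp inferInstance

/-- The linear function on `E` given by the pairing with an integer vector. -/
def formFun (a : Fin d → ℤ) : E → ℂ := fun y => ((form (intVec a) y : ℝ) : ℂ)

theorem formFun_mem (a : Fin d → ℤ) : formFun E a ∈ linFun E :=
  ⟨Complex.ofRealCLM.toLinearMap ∘ₗ (form (intVec a)).domRestrict E, fun _ => rfl⟩

variable {E}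

theorem eq_const_of_mem_pow_zero {f : E → ℂ} (hf : f ∈ linFun E ^ 0) (x y : E) : f x = f y := by
  rw [pow_zero, Submodule.mem_one] at hf
  obtain ⟨c, rfl⟩ := hf
  rfl

theorem eval_zero_of_mem_pow_succ {f : E → ℂ} {j : ℕ} (hf : f ∈ linFun E ^ (j + 1)) :
    f 0 = 0 := by
  rw [pow_succ] at hf
  induction hf using Submodule.mul_induction_on' with
  | mem_mul_mem m hm n hn =>
    obtain ⟨φ, hφ⟩ := hn
    simp [hφ]
  | add x hx y hy h1 h2 => simp [h1, h2]

theorem exists_polynomial_of_mem_pow {f : E → ℂ} {j : ℕ} (hf : f ∈ linFun E ^ j) (y η : E) :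
    ∃ p : ℂ[X], ∀ t : ℝ, f (y + t • η) = p.eval (t : ℂ) := by
  induction hf using Submodule.pow_induction_on_right' with
  | algebraMap r => exact ⟨C r, fun t => by simp⟩
  | add f g i hf hg h1 h2 =>
    obtain ⟨p, hp⟩ := h1
    obtain ⟨r, hr⟩ := h2
    exact ⟨p + r, fun t => by simp [hp, hr]⟩
  | mul_mem i f hf h1 m hm =>
    obtain ⟨p, hp⟩ := h1
    obtain ⟨φ, hφ⟩ := hm
    refine ⟨p * (C (φ y) + X * C (φ η)), fun t => ?_⟩
    rw [Pi.mul_apply, hp, hφ, map_add, map_smul, Complex.real_smul]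
    simp only [eval_mul, eval_add, eval_C, eval_X]

/-- The second parameter s permits moving the base point off a hyperplane and returning to it by
polynomial continuation. -/
theorem exists_polynomial_polynomial_of_mem_pow {f : E → ℂ} {j : ℕ} (hf : f ∈ linFun E ^ j)
    (y ξ η : E) : ∃ p : ℂ[X][X], ∀ s t : ℝ,
      f (y + s • ξ + t • η) = (p.map (evalRingHom (s : ℂ))).eval (t : ℂ) := by
  induction hf using Submodule.pow_induction_on_right' with
  | algebraMap r => exact ⟨C (C r), fun s t => by simp⟩
  | add f g i hf hg h1 h2 =>
    obtain ⟨p, hp⟩ := h1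
    obtain ⟨r, hr⟩ := h2
    exact ⟨p + r, fun s t => by simp [hp, hr]⟩
  | mul_mem i f hf h1 m hm =>
    obtain ⟨p, hp⟩ := h1
    obtain ⟨φ, hφ⟩ := hm
    refine ⟨p * (C (C (φ y) + X * C (φ ξ)) + X * C (C (φ η))), fun s t => ?_⟩
    rw [Pi.mul_apply, hp, hφ, map_add, map_add, map_smul, map_smul, Complex.real_smul,
      Complex.real_smul]
    simp only [map_mul, map_add, eval_mul, eval_add, eval_C, eval_X, Polynomial.map_mul,
      Polynomial.map_add, map_C, map_X, coe_evalRingHom]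

theorem comp_inclusion_mem_pow {E' : Submodule ℝ (Fin d → ℝ)} (h : E' ≤ E) {f : E → ℂ} {j : ℕ}
    (hf : f ∈ linFun E ^ j) : f ∘ Submodule.inclusion h ∈ linFun E' ^ j := by
  induction hf using Submodule.pow_induction_on_right' with
  | algebraMap r => rw [pow_zero]; exact Submodule.algebraMap_mem r
  | add f g i hf hg h1 h2 => exact Submodule.add_mem _ h1 h2
  | mul_mem i f hf h1 m hm =>
    obtain ⟨φ, hφ⟩ := hm
    rw [pow_succ]
    exact Submodule.mul_mem_mul h1 ⟨φ ∘ₗ Submodule.inclusion h, fun y => hφ _⟩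

/-- Splitting off a linear form: a homogeneous function of degree `j + 1` is the sum of a function
that is constant in the direction `η` and of a multiple of the linear form `a`. -/
theorem exists_decomposition {a : Fin d → ℤ} {η : E} (hη : form (intVec a) (η : Fin d → ℝ) = 1)
    {j : ℕ} {f : E → ℂ} (hf : f ∈ linFun E ^ (j + 1)) :
    ∃ f₀ : E → ℂ, (∀ y, f₀ y = f₀ (y - form (intVec a) (y : Fin d → ℝ) • η)) ∧
      ∃ g ∈ linFun E ^ j, f = f₀ + formFun E a * g := by
  have hlin : ∀ l ∈ linFun E, ∃ l₀ ∈ linFun E,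
      (∀ y, l₀ y = l₀ (y - form (intVec a) (y : Fin d → ℝ) • η)) ∧
      ∃ c : ℂ, l = l₀ + c • formFun E a := by
    rintro l ⟨φ, hφ⟩
    refine ⟨l - φ η • formFun E a, Submodule.sub_mem _ ⟨φ, hφ⟩
      (Submodule.smul_mem _ _ (formFun_mem E a)), fun y => ?_, φ η, by simp⟩
    simp [hφ, formFun, hη]
    ring
  induction j generalizing f with
  | zero =>
    rw [zero_add, pow_one] at hf
    obtain ⟨l₀, -, h2, c, rfl⟩ := hlin f hf
    refine ⟨l₀, h2, algebraMap ℂ _ c, ?_, ?_⟩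
    · rw [pow_zero]; exact Submodule.algebraMap_mem c
    · rw [Algebra.smul_def, mul_comm]
  | succ j ih =>
    rw [pow_succ] at hf
    induction hf using Submodule.mul_induction_on' with
    | mem_mul_mem h hh l hl =>
      obtain ⟨h₀, hh₀, g, hg, hhg⟩ := ih hh
      obtain ⟨l₀, hl, hl₀, c, rfl⟩ := hlin l hl
      have hmem : h₀ ∈ linFun E ^ (j + 1) := by
        have : h₀ = h - formFun E a * g := by rw [hhg]; ring
        rw [this, pow_succ']
        refine Submodule.sub_mem _ ?_ (Submodule.mul_mem_mul (formFun_mem E a) hg)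
        rwa [← pow_succ']
      refine ⟨h₀ * l₀, fun y => ?_, c • h₀ + g * (l₀ + c • formFun E a), ?_, ?_⟩
      · rw [Pi.mul_apply, Pi.mul_apply, ← hh₀, ← hl₀]
      · refine Submodule.add_mem _ (Submodule.smul_mem _ _ hmem) ?_
        rw [pow_succ]
        exact Submodule.mul_mem_mul hg hl
      · rw [hhg]
        simp only [Algebra.smul_def]
        ring
    | add x hx y hy h1 h2 =>
      obtain ⟨x₀, hx₀, g, hg, rfl⟩ := h1
      obtain ⟨y₀, hy₀, g', hg', rfl⟩ := h2
      exact ⟨x₀ + y₀, fun y => by rw [Pi.add_apply, Pi.add_apply, ← hx₀, ← hy₀], g + g',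
        Submodule.add_mem _ hg hg', by ring⟩

end

/-- The number of entries of `L` which do not vanish on `η`. -/
def width {d : ℕ} (L : List (Fin d → ℤ)) (η : Fin d → ℝ) : ℕ :=
  open Classical in L.countP fun b => form (intVec b) η ≠ 0

theorem width_cons_of_eq {d : ℕ} {a : Fin d → ℤ} {L : List (Fin d → ℤ)} {η : Fin d → ℝ}
    (h : form (intVec a) η = 0) : width (a :: L) η = width L η := by
  simp [width, h]

theorem width_cons_of_ne {d : ℕ} {a : Fin d → ℤ} {L : List (Fin d → ℤ)} {η : Fin d → ℝ}
    (h : form (intVec a) η ≠ 0) : width (a :: L) η = width L η + 1 := by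
  simp [width, h]

theorem width_of_mem_perp {d : ℕ} {L : List (Fin d → ℤ)} {η : Fin d → ℝ}
    (h : η ∈ perp L) : width L η = 0 := by
  simpa [width] using mem_perp.mp h

/-- The homogeneous polynomial functions of degree `j` on `E` whose degree along every nonzero
direction `η ∈ H` is smaller than `κ (width L η)`. -/
def boundedFun {d : ℕ} (κ : ℕ → ℕ) (H : Set (Fin d → ℝ)) (L : List (Fin d → ℤ))
    (E : Submodule ℝ (Fin d → ℝ)) (j : ℕ) : Submodule ℂ (E → ℂ) where
  carrier := {f | f ∈ linFun E ^ j ∧ ∀ η : E, (η : Fin d → ℝ) ∈ H → η ≠ 0 → ∀ y : E,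
    ∃ p : ℂ[X], p.degree < (κ (width L η) : ℕ) ∧ ∀ t : ℝ, f (y + t • η) = p.eval (t : ℂ)}
  add_mem' := by
    rintro f g ⟨hf, hf'⟩ ⟨hg, hg'⟩
    refine ⟨Submodule.add_mem _ hf hg, fun η hη h0 y => ?_⟩
    obtain ⟨p, hp, hpf⟩ := hf' η hη h0 y
    obtain ⟨r, hr, hrg⟩ := hg' η hη h0 y
    exact ⟨p + r, (degree_add_le _ _).trans_lt (max_lt hp hr), fun t => by simp [hpf, hrg]⟩
  zero_mem' := ⟨Submodule.zero_mem _, fun η hη h0 y => ⟨0, by simp, fun t => by simp⟩⟩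
  smul_mem' := by
    rintro c f ⟨hf, hf'⟩
    refine ⟨Submodule.smul_mem _ _ hf, fun η hη h0 y => ?_⟩
    obtain ⟨p, hp, hpf⟩ := hf' η hη h0 y
    exact ⟨c • p, (degree_smul_le _ _).trans_lt hp, fun t => by simp [hpf]⟩

theorem finite_boundedFun {d : ℕ} (κ : ℕ → ℕ) (H : Set (Fin d → ℝ)) (L : List (Fin d → ℤ))
    (E : Submodule ℝ (Fin d → ℝ)) (j : ℕ) : Module.Finite ℂ (boundedFun κ H L E j) := by
  have : Module.Finite ℂ ↥(linFun E ^ j) := Module.Finite.iff_fg.mpr ((linFun_fg E).pow j)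
  exact Submodule.finiteDimensional_of_le (S₂ := linFun E ^ j) fun f hf => hf.1

theorem eq_of_forall_eval_real {p r : ℂ[X]} (h : ∀ t : ℝ, p.eval (t : ℂ) = r.eval (t : ℂ)) :
    p = r := by
  apply eq_of_infinite_eval_eq
  exact (Set.infinite_range_of_injective Complex.ofReal_injective).mono
    (by rintro _ ⟨t, rfl⟩; exact h t)

/-! ### Deletion-contraction inequality for the bounded functions -/

section

variable {d : ℕ} {κ : ℕ → ℕ} {H : Set (Fin d → ℝ)} {L : List (Fin d → ℤ)}
  {E : Submodule ℝ (Fin d → ℝ)} {j : ℕ}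

theorem boundedFun_cons_of_le {a : Fin d → ℤ} (h : E ≤ hyp a) :
    boundedFun κ H (a :: L) E j = boundedFun κ H L E j := by
  have : ∀ η : E, width (a :: L) (η : Fin d → ℝ) = width L η := fun η =>
    width_cons_of_eq (mem_hyp.mp (h η.2))
  ext f
  simp only [boundedFun, Submodule.mem_mk, AddSubmonoid.mem_mk, AddSubsemigroup.mem_mk,
    Set.mem_ofPred_eq, this]

theorem boundedFun_eq_bot {η : E} (hη : (η : Fin d → ℝ) ∈ H) (h0 : η ≠ 0)
    (hκ : κ (width L η) = 0) : boundedFun κ H L E j = ⊥ := by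
  rw [eq_bot_iff]
  rintro f ⟨-, hf⟩
  rw [Submodule.mem_bot]
  funext y
  obtain ⟨p, hp, hpf⟩ := hf η hη h0 y
  rw [hκ] at hp
  have hp0 : p = 0 := by
    rw [← degree_eq_bot]
    exact Nat.WithBot.lt_zero_iff.mp (by exact_mod_cast hp)
  simpa [hp0] using hpf 0

/-- Every direction has width 0, so the functions are constant along directions that span E. They
are therefore constant, and in positive degree zero. -/
theorem finrank_boundedFun_nil (hκ : κ 0 ≤ 1) (hH : E ≤ Submodule.span ℝ (H ∩ E)) :
    Module.finrank ℂ (boundedFun κ H [] E j) ≤ (1 : ℕ[X]).coeff j := by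
  have hconst : ∀ f ∈ boundedFun κ H [] E j, ∀ v ∈ Submodule.span ℝ (H ∩ E), ∀ hv : v ∈ E,
      ∀ y : E, f (y + ⟨v, hv⟩) = f y := by
    rintro f ⟨-, hf⟩ v hv
    have hone : ∀ η : E, (η : Fin d → ℝ) ∈ H → ∀ t : ℝ, ∀ y, f (y + t • η) = f y := by
      intro η hη t y
      by_cases h0 : η = 0
      · simp [h0]
      · obtain ⟨p, hp, hpf⟩ := hf η hη h0 y
        have hp1 : p.degree < (1 : ℕ) := lt_of_lt_of_le hp (by simpa [width] using hκ)
        rw [Nat.cast_one, Nat.WithBot.lt_one_iff_le_zero, degree_le_zero_iff] at hp1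
        rw [hp1] at hpf
        have h2 := hpf 0
        rw [hpf t, eval_C]
        rw [eval_C] at h2
        simpa using h2.symm
    induction hv using Submodule.closure_induction with
    | zero => intro hv y; congr 1; ext; simp
    | add x y hx hy h1 h2 =>
      intro hv z
      have hx' : x ∈ E := (Submodule.span_le.mpr Set.inter_subset_right) hx
      have hy' : y ∈ E := (Submodule.span_le.mpr Set.inter_subset_right) hy
      rw [← h1 hx' z, ← h2 hy' (z + ⟨x, hx'⟩), add_assoc]
      rfl
    | smul_mem r x hx =>
      intro hv z
      exact hone ⟨x, hx.2⟩ hx.1 r z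
  have hconst' : ∀ f ∈ boundedFun κ H [] E j, ∀ y : E, f y = f 0 := fun f hf y => by
    simpa using hconst f hf y (hH y.2) y.2 0
  have hfin := finite_boundedFun κ H [] E j
  have hle : Module.finrank ℂ (boundedFun κ H [] E j) ≤ 1 := by
    let T : boundedFun κ H [] E j →ₗ[ℂ] ℂ :=
      { toFun := fun f => (f : E → ℂ) 0
        map_add' := fun _ _ => rfl
        map_smul' := fun _ _ => rfl }
    have hT : Function.Injective T := by
      rw [injective_iff_map_eq_zero]
      intro f hf
      ext y
      rw [hconst' f f.2 y]
      exact hf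
    simpa using LinearMap.finrank_le_finrank_of_injective hT
  cases j with
  | zero => simpa using hle
  | succ j =>
    have : boundedFun κ H [] E (j + 1) = ⊥ := by
      rw [eq_bot_iff]
      intro f hf
      rw [Submodule.mem_bot]
      funext y
      rw [hconst' f hf y, eval_zero_of_mem_pow_succ hf.1]
      rfl
    rw [this]
    simp

theorem degree_lt_of_linear_mul {p : ℂ[X]} {α β : ℂ} (hβ : β ≠ 0) {k : ℕ}
    (h : ((C α + C β * X) * p).degree < ((k + 1 : ℕ) : WithBot ℕ)) : p.degree < (k : ℕ) := by
  rw [degree_mul, add_comm (C α), degree_linear hβ] at h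
  by_cases hp : p = 0
  · simp [hp]
  · rw [degree_eq_natDegree hp] at h ⊢
    norm_cast at h ⊢
    omega

/-- If a is nonzero on η, dividing by a lowers the degree along η by one, while the width also drops
by one and κ by at most one. If a vanishes on η, it is constant along the line, and division is
harmless off the hyperplane a = 0; the remaining lines follow by continuation. -/
theorem mem_boundedFun_of_mul {a : Fin d → ℤ} (hκ : ∀ w, κ (w + 1) ≤ κ w + 1)
    (hE : ¬ E ≤ hyp a) {g : E → ℂ} (hg : g ∈ linFun E ^ j)
    (h : formFun E a * g ∈ boundedFun κ H (a :: L) E (j + 1)) : g ∈ boundedFun κ H L E j := by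
  refine ⟨hg, fun η hη h0 y => ?_⟩
  by_cases ha : form (intVec a) (η : Fin d → ℝ) = 0
  · obtain ⟨ξ, hξ, hξa⟩ := Set.not_subset.mp hE
    rw [SetLike.mem_coe, mem_hyp] at hξa
    obtain ⟨p, hp⟩ := exists_polynomial_polynomial_of_mem_pow hg y ⟨ξ, hξ⟩ η
    have hoff : ∀ s : ℝ, form (intVec a) (y : Fin d → ℝ) + s * form (intVec a) ξ ≠ 0 →
        ∀ i, κ (width L η) ≤ i → (p.coeff i).eval (s : ℂ) = 0 := by
      intro s hs i hi
      obtain ⟨r, hr, hrf⟩ := h.2 η hη h0 (y + s • ⟨ξ, hξ⟩)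
      rw [width_cons_of_eq ha] at hr
      have hmul : C ((form (intVec a) (y : Fin d → ℝ) + s * form (intVec a) ξ : ℝ) : ℂ) *
          p.map (evalRingHom (s : ℂ)) = r := by
        apply eq_of_forall_eval_real
        intro t
        rw [← hrf, Pi.mul_apply, hp]
        simp [formFun, ha]
      have h1 : (p.map (evalRingHom (s : ℂ))).degree < (κ (width L η) : ℕ) := by
        rwa [← hmul, degree_C_mul (by exact_mod_cast hs)] at hr
      have h2 := coeff_eq_zero_of_degree_lt (h1.trans_le (Nat.cast_le.mpr hi))
      simpa [coeff_map] using h2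
    -- The coefficients of degree at least κ are polynomials in s that vanish for all real s but the
    -- one placing the line inside a = 0; hence they vanish identically, in particular at s = 0.
    have hcoeff : ∀ i, κ (width L η) ≤ i → p.coeff i = 0 := by
      intro i hi
      apply eq_zero_of_infinite_isRoot
      refine Set.Infinite.mono (s := Complex.ofReal ''
        {- (form (intVec a) (y : Fin d → ℝ) / form (intVec a) ξ)}ᶜ) ?_ ?_
      · rintro _ ⟨s, hs, rfl⟩
        refine hoff s (fun h0 => hs ?_) i hi
        rw [Set.mem_singleton_iff]
        field_simp
        linarith
      · exact (Set.finite_singleton _).infinite_compl.image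
          Complex.ofReal_injective.injOn
    refine ⟨p.map (evalRingHom ((0 : ℝ) : ℂ)), ?_, fun t => ?_⟩
    · rw [degree_lt_iff_coeff_zero]
      intro i hi
      rw [coeff_map, hcoeff i hi, map_zero]
    · rw [← hp]
      simp
  · obtain ⟨p, hp⟩ := exists_polynomial_of_mem_pow hg y η
    refine ⟨p, ?_, hp⟩
    obtain ⟨r, hr, hrf⟩ := h.2 η hη h0 y
    rw [width_cons_of_ne ha] at hr
    have : (C (form (intVec a) (y : Fin d → ℝ) : ℂ) + C (form (intVec a) (η : Fin d → ℝ) : ℂ) * X)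
        * p = r := by
      apply eq_of_forall_eval_real
      intro t
      rw [← hrf, Pi.mul_apply, hp]
      simp [formFun]
      ring_nf
      simp
    refine degree_lt_of_linear_mul (α := (form (intVec a) (y : Fin d → ℝ) : ℂ))
      (β := (form (intVec a) (η : Fin d → ℝ) : ℂ)) (by exact_mod_cast ha) ?_
    rw [this]
    exact lt_of_lt_of_le hr (by exact_mod_cast hκ _)

theorem finrank_boundedFun_cons {a : Fin d → ℤ} {k : ℕ}
    (hker : Module.finrank ℂ ↥(boundedFun κ H (a :: L) E j ⊓ LinearMap.ker
      (LinearMap.funLeft ℂ ℂ (Submodule.inclusion (inf_le_right : hyp a ⊓ E ≤ E)))) ≤ k) :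
    Module.finrank ℂ (boundedFun κ H (a :: L) E j) ≤
      k + Module.finrank ℂ (boundedFun κ H L (hyp a ⊓ E) j) := by
  have hfin := finite_boundedFun κ H (a :: L) E j
  have hfin' := finite_boundedFun κ H L (hyp a ⊓ E) j
  set res := LinearMap.funLeft ℂ ℂ (Submodule.inclusion (inf_le_right : hyp a ⊓ E ≤ E)) with hres
  have hmap : (boundedFun κ H (a :: L) E j).map res ≤ boundedFun κ H L (hyp a ⊓ E) j := by
    rintro _ ⟨f, ⟨hf, hf'⟩, rfl⟩
    refine ⟨comp_inclusion_mem_pow inf_le_right hf, fun η hη h0 y => ?_⟩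
    obtain ⟨p, hp, hpf⟩ := hf' (Submodule.inclusion inf_le_right η) hη
      (fun h => h0 (Submodule.inclusion_injective _ (h.trans (map_zero _).symm)))
      (Submodule.inclusion inf_le_right y)
    refine ⟨p, ?_, fun t => hpf t⟩
    rwa [Submodule.coe_inclusion, width_cons_of_eq (mem_hyp.mp η.2.1)] at hp
  have h1 := LinearMap.finrank_range_add_finrank_ker (res.domRestrict (boundedFun κ H (a :: L) E j))
  rw [LinearMap.range_domRestrict] at h1
  have h2 := Submodule.finrank_mono hmap
  have h3 : Module.finrank ℂ
      (LinearMap.ker (res.domRestrict (boundedFun κ H (a :: L) E j))) ≤ k := by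
    refine le_trans (le_of_eq ?_) hker
    rw [LinearMap.ker_domRestrict, ← Submodule.finrank_map_subtype_eq,
      Submodule.map_comap_subtype]
  omega

theorem finrank_boundedFun_cons_zero {a : Fin d → ℤ} :
    Module.finrank ℂ (boundedFun κ H (a :: L) E 0) ≤
      Module.finrank ℂ (boundedFun κ H L (hyp a ⊓ E) 0) := by
  refine (finrank_boundedFun_cons (k := 0) (le_of_eq ?_)).trans_eq (zero_add _)
  have : boundedFun κ H (a :: L) E 0 ⊓ LinearMap.ker
      (LinearMap.funLeft ℂ ℂ (Submodule.inclusion (inf_le_right : hyp a ⊓ E ≤ E))) = ⊥ := by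
    rw [eq_bot_iff]
    rintro f ⟨hf, hf0⟩
    rw [Submodule.mem_bot]
    funext y
    rw [eq_const_of_mem_pow_zero hf.1 y 0]
    exact congrFun (LinearMap.mem_ker.mp hf0) 0
  rw [this, finrank_bot]

/-- A function vanishing on the hyperplane a = 0 is a multiple of a, so the kernel of restriction is
the image under multiplication by a of the bounded functions for the deletion. -/
theorem finrank_boundedFun_cons_succ {a : Fin d → ℤ} (hκ : ∀ w, κ (w + 1) ≤ κ w + 1)
    (hE : ¬ E ≤ hyp a) :
    Module.finrank ℂ (boundedFun κ H (a :: L) E (j + 1)) ≤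
      Module.finrank ℂ (boundedFun κ H L E j) +
        Module.finrank ℂ (boundedFun κ H L (hyp a ⊓ E) (j + 1)) := by
  have hfin := finite_boundedFun κ H L E j
  refine finrank_boundedFun_cons ?_
  refine le_trans (Submodule.finrank_mono ?_)
    (Submodule.finrank_map_le (LinearMap.mulLeft ℂ (formFun E a)) (boundedFun κ H L E j))
  rintro f ⟨hf, hf0⟩
  obtain ⟨ξ, hξ, hξa⟩ := Set.not_subset.mp hE
  rw [SetLike.mem_coe, mem_hyp] at hξa
  have hη : form (intVec a) (((form (intVec a) ξ)⁻¹ • ⟨ξ, hξ⟩ : E) : Fin d → ℝ) = 1 := by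
    simp [hξa]
  set η : E := (form (intVec a) ξ)⁻¹ • ⟨ξ, hξ⟩
  obtain ⟨f₀, hf₀, g, hg, rfl⟩ := exists_decomposition hη hf.1
  have hzero : f₀ = 0 := by
    funext y
    rw [hf₀ y]
    have hmem : form (intVec a)
        ((y - form (intVec a) (y : Fin d → ℝ) • η : E) : Fin d → ℝ) = 0 := by
      simp [hη]
    have h1 := congrFun (LinearMap.mem_ker.mp hf0)
      ⟨_, mem_hyp.mpr hmem, (y - form (intVec a) (y : Fin d → ℝ) • η).2⟩
    have h2 : (f₀ + formFun E a * g) (y - form (intVec a) (y : Fin d → ℝ) • η) = 0 := h1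
    rw [Pi.add_apply, Pi.mul_apply, formFun, hmem] at h2
    simpa using h2
  rw [hzero, zero_add] at hf ⊢
  exact ⟨g, mem_boundedFun_of_mul hκ hE hg hf, rfl⟩

/-- The dimension of the space of bounded functions is bounded by the deletion-contraction
recursion. -/
theorem finrank_boundedFun_le {b : Bool} (h0 : κ 0 ≤ 1) (hκ : ∀ w, κ (w + 1) ≤ κ w + 1)
    (hb : b = true → κ 0 = 0 ∧ κ 1 = 0) {S : Set (Fin d → ℤ)}
    (hH : ∀ C : List (Fin d → ℤ), (∀ c ∈ C, c ∈ S) → perp C ≤ Submodule.span ℝ (H ∩ perp C))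
    (hL : ∀ a ∈ L, a ∈ S) (C : List (Fin d → ℤ)) (hC : ∀ c ∈ C, c ∈ S) :
    Module.finrank ℂ (boundedFun κ H L (perp C) j) ≤ (graded b L (perp C)).coeff j := by
  induction L generalizing C j with
  | nil => exact finrank_boundedFun_nil h0 (hH C hC)
  | cons a L ih =>
    have hL' : ∀ a ∈ L, a ∈ S := fun x hx => hL x (List.mem_cons_of_mem _ hx)
    rw [graded]
    split_ifs with h1 h2
    · rw [boundedFun_cons_of_le h1]
      exact ih hL' C hC
    · obtain ⟨rfl, hne⟩ := h2
      -- The nonzero space of vectors orthogonal to both C and L contains a nonzero test direction.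
      -- Its width in a :: L is at most 1, where κ is 0, so only the zero function remains.
      have hspan := hH (C ++ L) (by
        intro c hc
        rcases List.mem_append.mp hc with h | h
        exacts [hC c h, hL' c h])
      rw [perp_append] at hspan
      obtain ⟨η, hη, hη0⟩ : ∃ η ∈ H ∩ (perp C ⊓ perp L : Submodule ℝ (Fin d → ℝ)), η ≠ 0 := by
        by_contra! hcon
        apply hne
        rw [eq_bot_iff]
        refine hspan.trans (Submodule.span_le.mpr fun η hη => ?_)
        exact hcon η hη
      have hw := width_of_mem_perp hη.2.2
      rw [boundedFun_eq_bot (η := ⟨η, hη.2.1⟩) hη.1 (fun h => hη0 (congrArg Subtype.val h))]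
      · simp
      · by_cases ha : form (intVec a) η = 0
        · rw [width_cons_of_eq ha, hw, (hb rfl).1]
        · rw [width_cons_of_ne ha, hw, (hb rfl).2]
    · have hC' : ∀ c ∈ a :: C, c ∈ S := by
        intro c hc
        rcases List.mem_cons.mp hc with rfl | h
        exacts [hL c List.mem_cons_self, hC c h]
      have h3 := ih (j := j) hL' (a :: C) hC'
      rw [perp] at h3
      cases j with
      | zero =>
        refine finrank_boundedFun_cons_zero.trans (h3.trans ?_)
        simp
      | succ j =>
        refine (finrank_boundedFun_cons_succ hκ h1).trans ?_
        rw [Polynomial.coeff_add, Polynomial.coeff_X_mul]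
        exact add_le_add (ih hL' C hC) h3

end

end GradedEhrhart

end

noncomputable section

namespace GradedEhrhart

open Polynomial

/-! ### Counting lattice points by deletion and contraction -/

/-- Translation by α stays in the fibres of ρ. Descending by α inside the finite set X must stop, so
each fibre over X' contains a point of Y outside X + α. -/
theorem encard_add_encard_le {G G' : Type} [AddCommGroup G] [AddCommGroup G'] (ρ : G →+ G')
    {α : G} (hα : ρ α = 0) (hinf : ∀ k : ℕ, 0 < k → k • α ≠ 0) {X Y : Set G} {X' : Set G'}
    (hXY : X ⊆ Y) (hX : ∀ x ∈ X, x + α ∈ Y) (hX' : ∀ x' ∈ X', ∃ y ∈ Y, ρ y = x') :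
    X.encard + X'.encard ≤ Y.encard := by
  by_cases hfin : X.Finite
  · have hlift : ∀ x' ∈ X', ∃ y ∈ Y, y ∉ (· + α) '' X ∧ ρ y = x' := by
      intro x' hx'
      by_contra! hcon
      obtain ⟨y, hy, hyx⟩ := hX' x' hx'
      have hstep : ∀ y ∈ Y, ρ y = x' → y - α ∈ X ∧ ρ (y - α) = x' := by
        intro y hy hyx
        obtain ⟨x, hx, rfl⟩ : y ∈ (· + α) '' X := by
          by_contra h
          exact hcon y hy h hyx
        have : x + α - α = x := by abel
        refine ⟨by rwa [this], ?_⟩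
        rw [map_sub, hyx, hα, sub_zero]
      have hall : ∀ k : ℕ, y - (k + 1) • α ∈ X ∧ ρ (y - (k + 1) • α) = x' := by
        intro k
        induction k with
        | zero => simpa using hstep y hy hyx
        | succ k ih =>
          have := hstep _ (hXY ih.1) ih.2
          rwa [sub_sub, ← succ_nsmul] at this
      refine Set.infinite_of_injective_forall_mem (f := fun k : ℕ => y - (k + 1) • α) ?_
        (fun k => (hall k).1) hfin
      have hwlog : ∀ k l : ℕ, k < l → y - (k + 1) • α ≠ y - (l + 1) • α := by
        intro k l hkl h
        apply hinf (l - k) (by omega)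
        have h1 : (k + 1) • α = (l + 1) • α := sub_right_injective h
        have h2 : l + 1 = (l - k) + (k + 1) := by omega
        rw [h2, add_nsmul α (l - k) (k + 1)] at h1
        exact right_eq_add.mp h1
      intro k l h
      rcases lt_trichotomy k l with hkl | hkl | hkl
      · exact absurd h (hwlog k l hkl)
      · exact hkl
      · exact absurd h.symm (hwlog l k hkl)
    have h1 : X' ⊆ ρ '' (Y \ (· + α) '' X) := fun x' hx' => by
      obtain ⟨y, hy, hy', rfl⟩ := hlift x' hx'
      exact ⟨y, ⟨hy, hy'⟩, rfl⟩
    have h2 : ((· + α) '' X).encard = X.encard := (add_left_injective α).encard_image X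
    have h3 : (· + α) '' X ⊆ Y := by
      rintro _ ⟨x, hx, rfl⟩
      exact hX x hx
    calc X.encard + X'.encard ≤ ((· + α) '' X).encard + (Y \ (· + α) '' X).encard := by
          rw [h2]
          gcongr
          exact (Set.encard_le_encard h1).trans (Set.encard_image_le _ _)
      _ = Y.encard := by rw [add_comm, Set.encard_sdiff_add_encard_of_subset h3]
  · have : Y.Infinite := Set.Infinite.mono hXY hfin
    rw [this.encard_eq]
    exact le_top

/-- The sums `∑ t_b b` over the vectors `b` of a list, with coefficients in `T`. -/
def zon {d : ℕ} (T : Set ℝ) : List (Fin d → ℤ) → Set (Fin d → ℝ)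
  | [] => {0}
  | a :: L => {x | ∃ t ∈ T, ∃ y ∈ zon T L, x = y + t • intVec a}

/-- The linear form on `E` given by the pairing with a vector. -/
def res {d : ℕ} (E : Submodule ℝ (Fin d → ℝ)) : (Fin d → ℝ) →ₗ[ℝ] Module.Dual ℝ E :=
  LinearMap.domRestrict' E ∘ₗ form

theorem res_apply {d : ℕ} (E : Submodule ℝ (Fin d → ℝ)) (x : Fin d → ℝ) (y : E) :
    res E x y = form x y := rfl

theorem res_intVec_eq_zero {d : ℕ} {E : Submodule ℝ (Fin d → ℝ)} {a : Fin d → ℤ} :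
    res E (intVec a) = 0 ↔ E ≤ hyp a := by
  constructor
  · intro h y hy
    exact mem_hyp.mpr (LinearMap.congr_fun h ⟨y, hy⟩)
  · intro h
    ext y
    exact mem_hyp.mp (h y.2)

theorem intVec_add {d : ℕ} (a b : Fin d → ℤ) : intVec (a + b) = intVec a + intVec b := by
  ext; simp [intVec]

theorem intVec_zsmul {d : ℕ} (k : ℤ) (a : Fin d → ℤ) : intVec (k • a) = (k : ℝ) • intVec a := by
  ext; simp [intVec]

/-- The restrictions to `E` of lattice points that agree on `E` with a point of `zon T L`. -/
def points {d : ℕ} (T : Set ℝ) (L : List (Fin d → ℤ)) (E : Submodule ℝ (Fin d → ℝ)) :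
    Set (Module.Dual ℝ E) :=
  {φ | (∃ z : Fin d → ℤ, φ = res E (intVec z)) ∧ ∃ x ∈ zon T L, φ = res E x}

section

variable {d : ℕ} {T : Set ℝ} {L : List (Fin d → ℤ)} {E : Submodule ℝ (Fin d → ℝ)}

/-- If `a` does not vanish on `E`, a vector whose restriction to the hyperplane `a = 0` of `E` is
zero is a multiple of `a` on `E`. -/
theorem exists_smul_of_res_eq_zero {a : Fin d → ℤ} {x : Fin d → ℝ}
    (h : res (hyp a ⊓ E) x = 0) : ∃ s : ℝ, res E x = s • res E (intVec a) := by
  have h1 : res E x ∈ Submodule.span ℝ (Set.range fun _ : Unit => res E (intVec a)) := by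
    apply mem_span_of_iInf_ker_le_ker
    intro y hy
    simp only [Submodule.mem_iInf, LinearMap.mem_ker, forall_const] at hy
    exact LinearMap.congr_fun h ⟨y, mem_hyp.mpr hy, y.2⟩
  rw [Set.range_const, Submodule.mem_span_singleton] at h1
  obtain ⟨s, hs⟩ := h1
  exact ⟨s, hs.symm⟩

/-- A lattice lift z of φ differs on E from the zonotope point x by s • a. Subtracting ⌊s⌋ copies of
a leaves the coefficient `Int.fract s`, which is admissible. -/
theorem points_cons_of_fract {a : Fin d → ℤ} (hT : ∀ s : ℝ, Int.fract s = 0 ∨ Int.fract s ∈ T)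
    (hsub : points T L E ⊆ points T (a :: L) E) {φ : Module.Dual ℝ ↥(hyp a ⊓ E)}
    (hφ : φ ∈ points T L (hyp a ⊓ E)) : ∃ ψ ∈ points T (a :: L) E,
      ψ ∘ₗ Submodule.inclusion inf_le_right = φ := by
  obtain ⟨⟨z, hz⟩, x, hx, hxφ⟩ := hφ
  obtain ⟨s, hs⟩ : ∃ s : ℝ, res E (intVec z - x) = s • res E (intVec a) :=
    exists_smul_of_res_eq_zero (by rw [map_sub, ← hz, ← hxφ, sub_self])
  rw [map_sub, sub_eq_iff_eq_add] at hs
  have hval : res E (intVec (z + (-⌊s⌋) • a)) = res E (x + Int.fract s • intVec a) := by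
    rw [intVec_add, intVec_zsmul, map_add, map_add, map_smul, map_smul, hs, Int.fract]
    push_cast
    module
  refine ⟨res E (intVec (z + (-⌊s⌋) • a)), ?_, ?_⟩
  · rcases hT s with h0 | h1
    · rw [h0, zero_smul, add_zero] at hval
      exact hsub ⟨⟨_, rfl⟩, x, hx, hval⟩
    · exact ⟨⟨_, rfl⟩, _, ⟨_, h1, x, hx, rfl⟩, hval⟩
  · rw [hz]
    ext y
    have hy : form (intVec a) (y : Fin d → ℝ) = 0 := mem_hyp.mp y.2.1
    change form (intVec (z + (-⌊s⌋) • a)) (y : Fin d → ℝ) = form (intVec z) (y : Fin d → ℝ)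
    rw [intVec_add, intVec_zsmul, map_add, map_smul, LinearMap.add_apply, LinearMap.smul_apply, hy,
      smul_zero, add_zero]

theorem encard_points_cons {a : Fin d → ℤ} (hE : ¬ E ≤ hyp a)
    (hT : ∀ s : ℝ, Int.fract s = 0 ∨ Int.fract s ∈ T)
    (hsub : points T L E ⊆ points T (a :: L) E)
    (hadd : ∀ φ ∈ points T L E, φ + res E (intVec a) ∈ points T (a :: L) E) :
    (points T L E).encard + (points T L (hyp a ⊓ E)).encard ≤ (points T (a :: L) E).encard := by
  refine encard_add_encard_le
    ((Submodule.inclusion (inf_le_right : hyp a ⊓ E ≤ E)).dualMap.toAddMonoidHom)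
    (α := res E (intVec a)) ?_ ?_ hsub hadd fun φ hφ => points_cons_of_fract hT hsub hφ
  · ext y
    exact mem_hyp.mp y.2.1
  · intro k hk h0
    rw [smul_eq_zero] at h0
    rcases h0 with h0 | h0
    · omega
    · exact hE (res_intVec_eq_zero.mp h0)

theorem points_cons_of_le {a : Fin d → ℤ} (hE : E ≤ hyp a) (hT : T.Nonempty) :
    points T (a :: L) E = points T L E := by
  have h0 := res_intVec_eq_zero.mpr hE
  ext φ
  constructor
  · rintro ⟨hz, _, ⟨t, ht, y, hy, rfl⟩, h⟩
    exact ⟨hz, y, hy, by rw [h, map_add, map_smul, h0, smul_zero, add_zero]⟩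
  · rintro ⟨hz, y, hy, h⟩
    obtain ⟨t, ht⟩ := hT
    exact ⟨hz, _, ⟨t, ht, y, hy, rfl⟩, by rw [h, map_add, map_smul, h0, smul_zero, add_zero]⟩

theorem points_nil : points T [] E = {0} := by
  ext φ
  constructor
  · rintro ⟨-, x, rfl, h⟩
    simpa using h
  · rintro rfl
    refine ⟨⟨0, ?_⟩, 0, rfl, by simp⟩
    have : intVec (0 : Fin d → ℤ) = 0 := by ext; simp [intVec]
    rw [this, map_zero]

theorem eventually_add_smul_mem_zon {v : Fin d → ℝ}
    (hv : v ∈ Submodule.span ℝ (intVec '' {b | b ∈ L})) {x : Fin d → ℝ}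
    (hx : x ∈ zon (Set.Ioo 0 1) L) : ∀ᶠ s : ℝ in nhds 0, x + s • v ∈ zon (Set.Ioo 0 1) L := by
  induction L generalizing v x with
  | nil =>
    have : v = 0 := by simpa using hv
    simpa [this] using hx
  | cons b L ih =>
    have hset : {c | c ∈ b :: L} = insert b {c | c ∈ L} := by ext; simp
    rw [hset, Set.image_insert_eq, Submodule.mem_span_insert] at hv
    obtain ⟨c, w, hw, rfl⟩ := hv
    obtain ⟨t, ht, y, hy, rfl⟩ := hx
    have h1 : ∀ᶠ s : ℝ in nhds 0, t + s * c ∈ Set.Ioo (0 : ℝ) 1 := by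
      have hcont : ContinuousAt (fun s : ℝ => t + s * c) 0 := by fun_prop
      exact hcont.eventually_mem (by simpa using isOpen_Ioo.mem_nhds ht)
    filter_upwards [h1, ih hw hy] with s hs hs'
    exact ⟨_, hs, _, hs', by module⟩

theorem res_mem_span_of_perp {a : Fin d → ℤ} (h : E ⊓ perp L = ⊥) :
    ∃ v ∈ Submodule.span ℝ (intVec '' {b | b ∈ L}), res E v = res E (intVec a) := by
  have h1 : res E (intVec a) ∈ Submodule.span ℝ
      (Set.range fun b : {b // b ∈ L} => res E (intVec b.1)) := by
    have : Finite {b // b ∈ L} := List.finite_toSet L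
    apply mem_span_of_iInf_ker_le_ker
    intro y hy
    simp only [Submodule.mem_iInf, LinearMap.mem_ker] at hy
    have h0 : (y : Fin d → ℝ) ∈ E ⊓ perp L := ⟨y.2, mem_perp.mpr fun b hb => hy ⟨b, hb⟩⟩
    rw [h, Submodule.mem_bot] at h0
    rw [LinearMap.mem_ker, res_apply, h0, map_zero]
  have h2 : (Set.range fun b : {b // b ∈ L} => res E (intVec b.1)) =
      res E '' (intVec '' {b | b ∈ L}) := by
    rw [Set.image_image, Set.image_eq_range]
    rfl
  rw [h2, ← Submodule.map_span] at h1
  exact h1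

/-- Open coefficients exclude 0 and 1. Since a agrees on E with some v in the span of L, a small
amount can be traded: x = (x - s v) + s a and x + a = (x + s v) + (1 - s) a on E. -/
theorem points_subset_of_perp {a : Fin d → ℤ} (h : E ⊓ perp L = ⊥) :
    points (Set.Ioo 0 1) L E ⊆ points (Set.Ioo 0 1) (a :: L) E ∧
      ∀ φ ∈ points (Set.Ioo 0 1) L E, φ + res E (intVec a) ∈ points (Set.Ioo 0 1) (a :: L) E := by
  obtain ⟨v, hv, hva⟩ := res_mem_span_of_perp (a := a) h
  have key : ∀ x ∈ zon (Set.Ioo 0 1) L, ∃ s ∈ Set.Ioo (0 : ℝ) 1,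
      x + s • v ∈ zon (Set.Ioo 0 1) L ∧ x + (-s) • v ∈ zon (Set.Ioo 0 1) L := by
    intro x hx
    have h1 := eventually_add_smul_mem_zon hv hx
    have h2 := eventually_add_smul_mem_zon (Submodule.neg_mem _ hv) hx
    have h3 := ((h1.and h2).filter_mono nhdsWithin_le_nhds).and
      (Ioo_mem_nhdsGT (zero_lt_one (α := ℝ)))
    obtain ⟨s, ⟨hs1, hs2⟩, hs3⟩ := h3.exists
    exact ⟨s, hs3, hs1, by rwa [neg_smul, ← smul_neg]⟩
  constructor
  · rintro φ ⟨hz, x, hx, rfl⟩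
    obtain ⟨s, hs, -, h2⟩ := key x hx
    refine ⟨hz, _, ⟨s, hs, _, h2, rfl⟩, ?_⟩
    simp only [map_add, map_smul, hva]
    module
  · rintro φ ⟨⟨z, hz⟩, x, hx, rfl⟩
    obtain ⟨s, hs, h1, -⟩ := key x hx
    refine ⟨⟨z + a, ?_⟩, _, ⟨1 - s, ⟨by linarith [hs.2], by linarith [hs.1]⟩, _, h1, rfl⟩, ?_⟩
    · rw [hz, intVec_add, map_add]
    · simp only [map_add, map_smul, hva]
      module

theorem points_Icc_subset {a : Fin d → ℤ} :
    points (Set.Icc 0 1) L E ⊆ points (Set.Icc 0 1) (a :: L) E ∧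
      ∀ φ ∈ points (Set.Icc 0 1) L E, φ + res E (intVec a) ∈ points (Set.Icc 0 1) (a :: L) E := by
  constructor
  · rintro φ ⟨hz, x, hx, rfl⟩
    exact ⟨hz, _, ⟨0, by simp, x, hx, rfl⟩, by simp⟩
  · rintro φ ⟨⟨z, hz⟩, x, hx, rfl⟩
    exact ⟨⟨z + a, by rw [hz, intVec_add, map_add]⟩, _, ⟨1, by simp, x, hx, rfl⟩, by simp⟩

/-- The interval of coefficients: `[0, 1]` for lattice points, `(0, 1)` for interior ones. -/
def coeffSet (b : Bool) : Set ℝ := if b then Set.Ioo 0 1 else Set.Icc 0 1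

theorem eval_graded_le_encard_points (b : Bool) :
    (((graded b L E).eval 1 : ℕ) : ℕ∞) ≤ (points (coeffSet b) L E).encard := by
  have hne : (coeffSet b).Nonempty := by
    refine ⟨1 / 2, ?_⟩
    unfold coeffSet
    split_ifs <;> norm_num
  have hfract : ∀ s : ℝ, Int.fract s = 0 ∨ Int.fract s ∈ coeffSet b := by
    intro s
    rcases (Int.fract_nonneg s).eq_or_lt with h | h
    · exact Or.inl h.symm
    · right
      unfold coeffSet
      split_ifs
      exacts [⟨h, Int.fract_lt_one s⟩, ⟨h.le, (Int.fract_lt_one s).le⟩]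
  induction L generalizing E with
  | nil => simp [graded, points_nil]
  | cons a L ih =>
    rw [graded]
    split_ifs with h1 h2
    · rw [points_cons_of_le h1 hne]
      exact ih
    · simp
    · have hsub : points (coeffSet b) L E ⊆ points (coeffSet b) (a :: L) E ∧
          ∀ φ ∈ points (coeffSet b) L E,
            φ + res E (intVec a) ∈ points (coeffSet b) (a :: L) E := by
        cases b with
        | false => exact points_Icc_subset
        | true => exact points_subset_of_perp (by simpa using h2)
      refine le_trans ?_ (encard_points_cons h1 hfract hsub.1 hsub.2)
      rw [eval_add, eval_mul, eval_X, one_mul, Nat.cast_add]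
      exact add_le_add ih ih

end

end GradedEhrhart

end

noncomputable section

namespace GradedEhrhart

/-! ### Orbit harmonics -/

section

variable {d : ℕ}

open MvPolynomial

theorem homogeneousComponent_mul_of_isHomogeneous {p f : MvPolynomial (Fin d) ℂ} {i : ℕ}
    (hp : p.IsHomogeneous i) (k : ℕ) : homogeneousComponent k (p * f) =
      if i ≤ k then p * homogeneousComponent (k - i) f else 0 := by
  conv_lhs => rw [← sum_homogeneousComponent f, Finset.mul_sum, map_sum]
  have h1 : ∀ j ∈ Finset.range (f.totalDegree + 1),
      homogeneousComponent k (p * homogeneousComponent j f) =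
        if k = i + j then p * homogeneousComponent j f else 0 := fun j _ =>
    homogeneousComponent_of_mem (hp.mul (homogeneousComponent_isHomogeneous j f))
  rw [Finset.sum_congr rfl h1]
  split_ifs with h
  · rw [Finset.sum_eq_single (k - i)]
    · rw [if_pos (by omega)]
    · intro j _ hj
      rw [if_neg (by omega)]
    · intro hj
      rw [homogeneousComponent_eq_zero _ _ (by
        rw [Finset.mem_range] at hj
        omega), mul_zero, ite_self]
  · refine Finset.sum_eq_zero fun j _ => ?_
    rw [if_neg (by omega)]

theorem homogeneousComponent_mem_gr {I : Ideal (MvPolynomial (Fin d) ℂ)}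
    {f : MvPolynomial (Fin d) ℂ} (hf : f ∈ I) {k : ℕ} (hk : f.totalDegree ≤ k) :
    homogeneousComponent k f ∈ gr I := by
  rcases hk.eq_or_lt with h | h
  · exact Ideal.subset_span ⟨f, hf, by rw [h]⟩
  · rw [homogeneousComponent_eq_zero _ _ h]
    exact Ideal.zero_mem _

/-- Homogeneous components of elements of `gr I` are top degree components of elements of `I`. -/
theorem exists_mem_of_mem_gr {I : Ideal (MvPolynomial (Fin d) ℂ)} {f : MvPolynomial (Fin d) ℂ}
    (hf : f ∈ gr I) (k : ℕ) :
    ∃ g ∈ I, g.totalDegree ≤ k ∧ homogeneousComponent k g = homogeneousComponent k f := by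
  induction hf using Submodule.span_induction generalizing k with
  | mem f hf =>
    obtain ⟨g, hg, rfl⟩ := hf
    by_cases hk : k = g.totalDegree
    · refine ⟨g, hg, hk.ge, ?_⟩
      rw [homogeneousComponent_of_mem (homogeneousComponent_isHomogeneous g.totalDegree g),
        if_pos hk, hk]
    · refine ⟨0, I.zero_mem, by simp, ?_⟩
      rw [homogeneousComponent_of_mem (homogeneousComponent_isHomogeneous g.totalDegree g),
        if_neg hk, map_zero]
  | zero => exact ⟨0, I.zero_mem, by simp, rfl⟩
  | add f f' _ _ h1 h2 =>
    obtain ⟨g, hg, hgk, hgf⟩ := h1 k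
    obtain ⟨g', hg', hgk', hgf'⟩ := h2 k
    exact ⟨g + g', I.add_mem hg hg', (totalDegree_add _ _).trans (max_le hgk hgk'), by
      rw [map_add, map_add, hgf, hgf']⟩
  | smul p f _ h =>
    -- The multiplier is split into homogeneous components, each of which shifts degrees uniformly.
    have hhom : ∀ i, ∃ g ∈ I, g.totalDegree ≤ k ∧
        homogeneousComponent k g = homogeneousComponent k (homogeneousComponent i p * f) := by
      intro i
      rw [homogeneousComponent_mul_of_isHomogeneous (homogeneousComponent_isHomogeneous i p)]
      split_ifs with hi
      · obtain ⟨g, hg, hgk, hgf⟩ := h (k - i)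
        refine ⟨homogeneousComponent i p * g, I.mul_mem_left _ hg, ?_, ?_⟩
        · refine (totalDegree_mul _ _).trans ?_
          have := (homogeneousComponent_isHomogeneous i p).totalDegree_le
          omega
        · rw [homogeneousComponent_mul_of_isHomogeneous (homogeneousComponent_isHomogeneous i p),
            if_pos hi, hgf]
      · exact ⟨0, I.zero_mem, by simp, map_zero _⟩
    choose g hg hgk hgf using hhom
    refine ⟨∑ i ∈ Finset.range (p.totalDegree + 1), g i, I.sum_mem fun i _ => hg i,
      totalDegree_finsetSum_le fun i _ => hgk i, ?_⟩
    rw [map_sum, Finset.sum_congr rfl fun i _ => hgf i, ← map_sum, ← Finset.sum_mul,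
      sum_homogeneousComponent, smul_eq_mul]

/-- Lagrange interpolation, with separating factors built from a coordinate in which two points
differ. -/
theorem exists_eval_eq (Z : Finset (Fin d → ℂ)) (v : Z → ℂ) :
    ∃ f : MvPolynomial (Fin d) ℂ, ∀ z : Z, aeval (z : Fin d → ℂ) f = v z := by
  classical
  have hsep : ∀ z w : Fin d → ℂ, ∃ f : MvPolynomial (Fin d) ℂ,
      z ≠ w → aeval z f = 1 ∧ aeval w f = 0 := by
    intro z w
    by_cases h : z = w
    · exact ⟨0, fun h' => absurd h h'⟩
    · obtain ⟨i, hi⟩ := Function.ne_iff.mp h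
      refine ⟨C (z i - w i)⁻¹ * (X i - C (w i)), fun _ => ⟨?_, ?_⟩⟩
      · simp [inv_mul_cancel₀ (sub_ne_zero.mpr hi)]
      · simp
  choose p hp using hsep
  refine ⟨∑ z : Z, C (v z) * ∏ w ∈ Z.erase z, p z w, fun z => ?_⟩
  rw [map_sum, Finset.sum_eq_single z]
  · rw [map_mul, map_prod, Finset.prod_eq_one]
    · simp
    · intro w hw
      exact (hp _ _ (Finset.ne_of_mem_erase hw).symm).1
  · intro w _ hwz
    have hne : (w : Fin d → ℂ) ≠ z := fun h => hwz (Subtype.ext h)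
    rw [map_mul, map_prod, Finset.prod_eq_zero (Finset.mem_erase.mpr ⟨hne.symm, z.2⟩)
      (hp _ _ hne).2, mul_zero]
  · simp

theorem finite_orbPiece (𝒵 : Set (Fin d → ℂ)) (k : ℕ) : Module.Finite ℂ (orbPiece 𝒵 k) :=
  Module.Finite.iff_fg.mpr ((homogeneousSubmodule_fg _ _ k).map _)

theorem exists_section_orbPiece (𝒵 : Set (Fin d → ℂ)) (k : ℕ) :
    ∃ s : orbPiece 𝒵 k →ₗ[ℂ] MvPolynomial (Fin d) ℂ, ∀ v, s v ∈ homogeneousSubmodule (Fin d) ℂ k ∧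
      Ideal.Quotient.mk _ (s v) = (v : Orb 𝒵) := by
  let π := (Ideal.Quotient.mkₐ ℂ (gr (vanishingIdeal ℂ 𝒵))).toLinearMap.submoduleMap
    (homogeneousSubmodule (Fin d) ℂ k)
  obtain ⟨s, hs⟩ := LinearMap.exists_rightInverse_of_surjective π
    (LinearMap.range_eq_top.mpr (LinearMap.submoduleMap_surjective _ _))
  refine ⟨(homogeneousSubmodule (Fin d) ℂ k).subtype ∘ₗ s, fun v => ⟨(s v).2, ?_⟩⟩
  exact congrArg Subtype.val (LinearMap.congr_fun hs v)

/-- The number of points is at most the sum of the dimensions of the graded pieces. -/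
theorem card_le_sum_finrank_orbPiece {𝒵 : Set (Fin d → ℂ)} {Z : Finset (Fin d → ℂ)}
    (hZ : (Z : Set (Fin d → ℂ)) ⊆ 𝒵) {M : ℕ}
    (hM : ∀ k, M ≤ k → Module.finrank ℂ (orbPiece 𝒵 k) = 0) :
    Z.card ≤ ∑ k ∈ Finset.range M, Module.finrank ℂ (orbPiece 𝒵 k) := by
  have hfin := fun k => finite_orbPiece 𝒵 k
  choose s hs hsmk using exists_section_orbPiece 𝒵
  let Φ : ((k : Fin M) → orbPiece 𝒵 k) →ₗ[ℂ] MvPolynomial (Fin d) ℂ :=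
    ∑ k : Fin M, s k ∘ₗ LinearMap.proj k
  have hrange : ∀ k (v : orbPiece 𝒵 k), s k v ∈ LinearMap.range Φ := by
    intro k v
    by_cases hk : k < M
    · refine ⟨Pi.single (⟨k, hk⟩ : Fin M) v, ?_⟩
      rw [LinearMap.sum_apply, Finset.sum_eq_single (⟨k, hk⟩ : Fin M)]
      · simp
      · intro j _ hj
        simp [Pi.single_eq_of_ne hj]
      · simp
    · have : Subsingleton (orbPiece 𝒵 k) :=
        Module.finrank_zero_iff.mp (hM k (not_lt.mp hk))
      rw [Subsingleton.elim v 0, map_zero]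
      exact Submodule.zero_mem _
  -- Reduction from the top degree: the leading component equals its chosen representative modulo gr
  -- I, and the difference is the leading component of some g in the vanishing ideal. Subtracting
  -- both lowers the degree.
  have key : ∀ N, ∀ f : MvPolynomial (Fin d) ℂ, (∀ k, N ≤ k → homogeneousComponent k f = 0) →
      ∃ b ∈ LinearMap.range Φ, f - b ∈ vanishingIdeal ℂ 𝒵 := by
    intro N
    induction N with
    | zero =>
      intro f hf
      refine ⟨0, Submodule.zero_mem _, ?_⟩
      rw [← sum_homogeneousComponent f, Finset.sum_eq_zero fun k _ => hf k (Nat.zero_le k),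
        sub_zero]
      exact Ideal.zero_mem _
    | succ N ih =>
      intro f hf
      have hfN := homogeneousComponent_isHomogeneous N f
      set v : orbPiece 𝒵 N := ⟨Ideal.Quotient.mk _ (homogeneousComponent N f), _, hfN, rfl⟩
      have hb := hs N v
      have hgr : homogeneousComponent N f - s N v ∈ gr (vanishingIdeal ℂ 𝒵) := by
        rw [← Ideal.Quotient.eq, hsmk N v]
      obtain ⟨g, hg, hgN, hgf⟩ := exists_mem_of_mem_gr hgr N
      obtain ⟨b, hbr, hbI⟩ := ih (f - s N v - g) (by
        intro k hk
        rcases hk.eq_or_lt with rfl | hk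
        · rw [map_sub, map_sub, hgf, map_sub, homogeneousComponent_of_mem hfN, if_pos rfl, sub_self]
        · rw [map_sub, map_sub, hf k hk, homogeneousComponent_of_mem hb, if_neg hk.ne',
            homogeneousComponent_eq_zero _ _ (hgN.trans_lt hk), sub_zero, sub_zero])
      refine ⟨s N v + b, Submodule.add_mem _ (hrange N v) hbr, ?_⟩
      have : f - (s N v + b) = (f - s N v - g - b) + g := by ring
      rw [this]
      exact Ideal.add_mem _ hbI hg
  let ev : MvPolynomial (Fin d) ℂ →ₗ[ℂ] (Z → ℂ) :=
    LinearMap.pi fun z => (aeval (z : Fin d → ℂ)).toLinearMap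
  have hsurj : Function.Surjective (ev ∘ₗ Φ) := by
    intro v
    obtain ⟨f, hf⟩ := exists_eval_eq Z v
    obtain ⟨b, ⟨u, rfl⟩, hb⟩ := key (f.totalDegree + 1) f
      (fun k hk => homogeneousComponent_eq_zero _ _ hk)
    refine ⟨u, ?_⟩
    funext z
    have h1 := (mem_vanishingIdeal_iff.mp hb) z (hZ z.2)
    rw [map_sub, hf, sub_eq_zero] at h1
    exact h1.symm
  have h1 := LinearMap.finrank_le_finrank_of_surjective hsurj
  rw [Module.finrank_pi, Module.finrank_pi_fintype, Fintype.card_coe] at h1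
  rwa [Finset.sum_range]

/-! ### Macaulay duality and relations in the associated graded ideal -/

/-- The linear polynomial with given real coefficients. -/
def linPoly (y : Fin d → ℝ) : MvPolynomial (Fin d) ℂ := ∑ i, C (y i : ℂ) * X i

theorem linPoly_add (x y : Fin d → ℝ) : linPoly (x + y) = linPoly x + linPoly y := by
  simp [linPoly, add_mul, Finset.sum_add_distrib]

theorem linPoly_smul (t : ℝ) (y : Fin d → ℝ) : linPoly (t • y) = C (t : ℂ) * linPoly y := by
  simp [linPoly, Finset.mul_sum, mul_assoc]

theorem linPoly_isHomogeneous (y : Fin d → ℝ) : (linPoly y).IsHomogeneous 1 :=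
  IsHomogeneous.sum _ _ _ fun i _ => isHomogeneous_C_mul_X _ i

theorem linPoly_single (i : Fin d) : linPoly (Pi.single i 1) = X i := by
  rw [linPoly, Finset.sum_eq_single i]
  · simp
  · intro j _ hj
    simp [hj]
  · simp

/-- A linear functional which vanishes on the powers of the real linear forms vanishes on all
homogeneous polynomials. -/
theorem eq_zero_of_linPoly_pow {k : ℕ} (μ : MvPolynomial (Fin d) ℂ →ₗ[ℂ] ℂ)
    (h : ∀ y, μ (linPoly y ^ k) = 0) {p : MvPolynomial (Fin d) ℂ}
    (hp : p ∈ homogeneousSubmodule (Fin d) ℂ k) : μ p = 0 := by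
  rw [← homogeneousSubmodule_one_pow, homogeneousSubmodule_one_eq_span_X] at hp
  induction k generalizing μ p with
  | zero =>
    rw [pow_zero, Submodule.mem_one] at hp
    obtain ⟨c, rfl⟩ := hp
    have h1 := h 0
    rw [pow_zero] at h1
    rw [Algebra.algebraMap_eq_smul_one, map_smul, h1, smul_zero]
  | succ k ih =>
    have hX : ∀ i, ∀ y, μ (X i * linPoly y ^ k) = 0 := by
      intro i y
      -- Polarisation: μ((t xᵢ + y)^(k+1)) vanishes for all real t, and its coefficient at t is (k +
      -- 1) μ(xᵢ y^k).
      have hpoly : ∀ t : ℝ, (∑ m ∈ Finset.range (k + 1 + 1), Polynomial.C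
          (((k + 1).choose m : ℂ) * μ (X i ^ m * linPoly y ^ (k + 1 - m))) *
            Polynomial.X ^ m).eval (t : ℂ) = (0 : Polynomial ℂ).eval (t : ℂ) := by
        intro t
        rw [Polynomial.eval_zero, ← h (t • Pi.single i 1 + y), linPoly_add, linPoly_smul,
          linPoly_single, add_pow, map_sum, Polynomial.eval_finsetSum]
        refine Finset.sum_congr rfl fun m _ => ?_
        have : (C (t : ℂ) * X i) ^ m * linPoly y ^ (k + 1 - m) *
              (((k + 1).choose m : ℕ) : MvPolynomial (Fin d) ℂ) =
            ((t : ℂ) ^ m * ((k + 1).choose m : ℂ)) • (X i ^ m * linPoly y ^ (k + 1 - m)) := by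
          rw [smul_eq_C_mul, C_mul, C_pow, mul_pow, map_natCast]
          ring
        rw [this, map_smul]
        simp
        ring
      have h1 := congrArg (fun p => p.coeff 1) (eq_of_forall_eval_real hpoly)
      rw [Polynomial.finsetSum_coeff] at h1
      simp only [Polynomial.coeff_C_mul, Polynomial.coeff_X_pow] at h1
      rw [Finset.sum_eq_single 1] at h1
      · have h2 : ((k : ℂ) + 1) ≠ 0 := by exact_mod_cast Nat.succ_ne_zero k
        simpa [h2] using h1
      · intro m _ hm
        simp [hm.symm]
      · intro hm
        simp at hm
    rw [pow_succ'] at hp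
    induction hp using Submodule.mul_induction_on' with
    | mem_mul_mem x hx r hr =>
      induction hx using Submodule.span_induction with
      | mem x hx =>
        obtain ⟨i, rfl⟩ := hx
        exact ih (μ ∘ₗ LinearMap.mulLeft ℂ (X i)) (hX i) hr
      | zero => simp
      | add x y _ _ h1 h2 => rw [add_mul, map_add, h1, h2, add_zero]
      | smul c x _ h1 => rw [smul_mul_assoc, map_smul, h1, smul_zero]
    | add x _ y _ h1 h2 => rw [map_add, h1, h2, add_zero]

theorem linPoly_pow_mem_linFun (E : Submodule ℝ (Fin d → ℝ)) (k : ℕ)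
    (μ : MvPolynomial (Fin d) ℂ →ₗ[ℂ] ℂ) :
    (fun y : E => μ (linPoly (y : Fin d → ℝ) ^ k)) ∈ linFun E ^ k := by
  induction k generalizing μ with
  | zero =>
    simp only [pow_zero]
    exact Submodule.algebraMap_mem (A := E → ℂ) (μ 1)
  | succ k ih =>
    have h1 : (fun y : E => μ (linPoly (y : Fin d → ℝ) ^ (k + 1))) = ∑ i,
        (fun y : E => ((y : Fin d → ℝ) i : ℂ)) *
          fun y : E => (μ ∘ₗ LinearMap.mulLeft ℂ (X i)) (linPoly (y : Fin d → ℝ) ^ k) := by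
      funext y
      rw [Finset.sum_apply, pow_succ']
      nth_rewrite 1 [linPoly]
      rw [Finset.sum_mul, map_sum]
      refine Finset.sum_congr rfl fun i _ => ?_
      rw [mul_assoc, ← smul_eq_C_mul, map_smul]
      rfl
    rw [h1, pow_succ']
    refine Submodule.sum_mem _ fun i _ => Submodule.mul_mem_mul ?_ (ih _)
    exact ⟨Complex.ofRealCLM.toLinearMap ∘ₗ LinearMap.proj i ∘ₗ E.subtype, fun _ => rfl⟩

/-- A functional l on the graded piece becomes the function y ↦ l(y^k). Expanding (y + tη)^k, the
terms with at least κ factors η lie in gr I and disappear. Nothing is lost, since k-th powers of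
linear forms span the forms of degree k. -/
theorem finrank_orbPiece_le {𝒵 : Set (Fin d → ℂ)} {κ : ℕ → ℕ} {H : Set (Fin d → ℝ)}
    {L : List (Fin d → ℤ)}
    (hrel : ∀ η ∈ H, η ≠ 0 → linPoly η ^ κ (width L η) ∈ gr (vanishingIdeal ℂ 𝒵)) (k : ℕ) :
    Module.finrank ℂ (orbPiece 𝒵 k) ≤ Module.finrank ℂ (boundedFun κ H L ⊤ k) := by
  have hfin := finite_orbPiece 𝒵 k
  have hfin' := finite_boundedFun κ H L ⊤ k
  have hmem : ∀ y : Fin d → ℝ, Ideal.Quotient.mk _ (linPoly y ^ k) ∈ orbPiece 𝒵 k := fun y =>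
    ⟨_, by simpa using (linPoly_isHomogeneous y).pow k, rfl⟩
  let T : Module.Dual ℂ (orbPiece 𝒵 k) →ₗ[ℂ] ((⊤ : Submodule ℝ (Fin d → ℝ)) → ℂ) :=
    { toFun := fun l y => l ⟨_, hmem y⟩
      map_add' := fun _ _ => rfl
      map_smul' := fun _ _ => rfl }
  have hext : ∀ l : Module.Dual ℂ (orbPiece 𝒵 k), ∃ μ : MvPolynomial (Fin d) ℂ →ₗ[ℂ] ℂ,
      (∀ p ∈ gr (vanishingIdeal ℂ 𝒵), μ p = 0) ∧
      ∀ p (hp : Ideal.Quotient.mk _ p ∈ orbPiece 𝒵 k), l ⟨_, hp⟩ = μ p := by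
    intro l
    obtain ⟨l', hl'⟩ := LinearMap.exists_extend l
    refine ⟨l' ∘ₗ (Ideal.Quotient.mkₐ ℂ _).toLinearMap, fun p hp => ?_, fun p hp => ?_⟩
    · have : Ideal.Quotient.mk (gr (vanishingIdeal ℂ 𝒵)) p = 0 :=
        Ideal.Quotient.eq_zero_iff_mem.mpr hp
      change l' (Ideal.Quotient.mk _ p) = 0
      rw [this, map_zero]
    · exact (LinearMap.congr_fun hl' ⟨_, hp⟩).symm
  have hT : ∀ l, T l ∈ boundedFun κ H L ⊤ k := by
    intro l
    obtain ⟨μ, hμ, hl⟩ := hext l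
    have hTl : T l = fun y : (⊤ : Submodule ℝ (Fin d → ℝ)) => μ (linPoly (y : Fin d → ℝ) ^ k) :=
      funext fun y => hl _ _
    rw [hTl]
    refine ⟨linPoly_pow_mem_linFun _ k μ, fun η hη h0 y => ?_⟩
    have hη0 : (η : Fin d → ℝ) ≠ 0 := fun h => h0 (Subtype.ext h)
    set w := κ (width L η) with hw
    refine ⟨∑ m ∈ Finset.range (k + 1), Polynomial.C ((k.choose m : ℂ) *
      μ (linPoly (η : Fin d → ℝ) ^ m * linPoly (y : Fin d → ℝ) ^ (k - m))) * Polynomial.X ^ m,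
      ?_, fun t => ?_⟩
    · rw [Polynomial.degree_lt_iff_coeff_zero]
      intro j hj
      rw [Polynomial.finsetSum_coeff]
      refine Finset.sum_eq_zero fun m _ => ?_
      rw [Polynomial.coeff_C_mul, Polynomial.coeff_X_pow]
      split_ifs with h
      · subst h
        have hmem : linPoly (η : Fin d → ℝ) ^ j * linPoly (y : Fin d → ℝ) ^ (k - j) ∈
            gr (vanishingIdeal ℂ 𝒵) := by
          rw [← Nat.add_sub_cancel' hj, pow_add, mul_assoc]
          exact Ideal.mul_mem_right _ _ (hrel η hη hη0)
        rw [hμ _ hmem, mul_zero, zero_mul]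
      · rw [mul_zero]
    · have : ((y + t • η : (⊤ : Submodule ℝ (Fin d → ℝ))) : Fin d → ℝ) =
        t • (η : Fin d → ℝ) + y := by rw [add_comm]; rfl
      simp only [this]
      rw [linPoly_add, linPoly_smul, add_pow, map_sum, Polynomial.eval_finsetSum]
      refine Finset.sum_congr rfl fun m _ => ?_
      have h2 : (C (t : ℂ) * linPoly (η : Fin d → ℝ)) ^ m * linPoly (y : Fin d → ℝ) ^ (k - m) *
          ((k.choose m : ℕ) : MvPolynomial (Fin d) ℂ) = ((t : ℂ) ^ m * (k.choose m : ℂ)) •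
            (linPoly (η : Fin d → ℝ) ^ m * linPoly (y : Fin d → ℝ) ^ (k - m)) := by
        rw [smul_eq_C_mul, C_mul, C_pow, mul_pow, map_natCast]
        ring
      rw [h2, map_smul]
      simp
      ring
  have hinj : Function.Injective (T.codRestrict _ hT) := by
    rw [injective_iff_map_eq_zero]
    intro l hl
    obtain ⟨μ, hμ, hlμ⟩ := hext l
    have h0 : ∀ y, μ (linPoly y ^ k) = 0 := fun y => by
      rw [← hlμ _ (hmem y)]
      exact congrFun (congrArg Subtype.val hl) ⟨y, trivial⟩
    ext ⟨_, p, hp, rfl⟩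
    exact (hlμ p _).trans (eq_zero_of_linPoly_pow μ h0 hp)
  have h1 := LinearMap.finrank_le_finrank_of_injective hinj
  rwa [Subspace.dual_finrank_eq] at h1

/-- If an integer linear form takes at most `k` values on `𝒵`, its `k`-th power lies in `gr I`. -/
theorem linPoly_pow_mem_gr {𝒵 : Set (Fin d → ℂ)} {η : Fin d → ℝ} (S : Finset ℂ)
    (hS : ∀ z ∈ 𝒵, ∑ i, (η i : ℂ) * z i ∈ S) :
    linPoly η ^ S.card ∈ gr (vanishingIdeal ℂ 𝒵) := by
  -- P evaluated at the linear form vanishes on the point set, and its top component is the wanted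
  -- power.
  set P : Polynomial ℂ := ∏ v ∈ S, (Polynomial.X - Polynomial.C v) with hP
  have hmonic : P.Monic := Polynomial.monic_prod_of_monic _ _ fun v _ => Polynomial.monic_X_sub_C v
  have hdeg : P.natDegree = S.card := by
    rw [hP, Polynomial.natDegree_prod_of_monic _ _ fun v _ => Polynomial.monic_X_sub_C v]
    simp
  have hhom : ∀ j, (P.coeff j • linPoly η ^ j).IsHomogeneous j := fun j => by
    rw [smul_eq_C_mul]
    simpa using ((linPoly_isHomogeneous η).pow j).C_mul (P.coeff j)
  have hexp : Polynomial.aeval (linPoly η) P =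
      ∑ j ∈ Finset.range (S.card + 1), P.coeff j • linPoly η ^ j := by
    rw [Polynomial.aeval_eq_sum_range, hdeg]
  have hmem : Polynomial.aeval (linPoly η) P ∈ vanishingIdeal ℂ 𝒵 := by
    rw [mem_vanishingIdeal_iff]
    intro z hz
    have h1 : aeval z (linPoly η) = ∑ i, (η i : ℂ) * z i := by simp [linPoly]
    rw [hP, map_prod, map_prod]
    refine Finset.prod_eq_zero (hS z hz) ?_
    rw [map_sub, map_sub, Polynomial.aeval_X, Polynomial.aeval_C, h1, AlgHom.commutes]
    exact sub_self _
  have htd : (Polynomial.aeval (linPoly η) P).totalDegree ≤ S.card := by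
    rw [hexp]
    refine totalDegree_finsetSum_le fun j hj => (hhom j).totalDegree_le.trans ?_
    exact Nat.lt_succ_iff.mp (Finset.mem_range.mp hj)
  have h2 := homogeneousComponent_mem_gr hmem htd
  rw [hexp, map_sum, Finset.sum_eq_single S.card] at h2
  · rw [homogeneousComponent_of_mem (hhom _), if_pos rfl] at h2
    rw [← hdeg, hmonic.coeff_natDegree, one_smul, hdeg] at h2
    exact h2
  · intro j _ hj
    rw [homogeneousComponent_of_mem (hhom _), if_neg hj.symm]
  · simp

end

end GradedEhrhart

end

noncomputable section

namespace GradedEhrhart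

open Polynomial

/-! ### Quantum integers -/

theorem one_sub_q_ne_zero : (1 - q : RatFunc ℚ) ≠ 0 := by
  rw [sub_ne_zero]
  intro h
  have h1 : (algebraMap ℚ[X] (RatFunc ℚ)) X = algebraMap ℚ[X] (RatFunc ℚ) 1 := by
    rw [RatFunc.algebraMap_X, map_one]
    exact h.symm
  have h2 := RatFunc.algebraMap_injective ℚ h1
  have h3 := congrArg natDegree h2
  simp at h3

theorem q_ne_zero : (q : RatFunc ℚ) ≠ 0 := RatFunc.X_ne_zero

theorem one_sub_mul_qInt (n : ℤ) : 1 - (1 - q) * qInt n = q ^ n := by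
  rw [qInt, mul_div_cancel₀ _ one_sub_q_ne_zero]
  ring

theorem qInt_natCast (m : ℕ) : qInt m = ∑ i ∈ Finset.range m, q ^ i := by
  rw [qInt, div_eq_iff one_sub_q_ne_zero, zpow_natCast, geom_sum_mul_neg]

theorem invertQ_q : invertQ q = q⁻¹ := by
  have h := RatFunc.liftRingHom_apply_div (substInv ℚ)
    (nonZeroDivisors_le_comap_nonZeroDivisors_of_injective _ (substInv_injective ℚ)) X 1
  rw [map_one, map_one, div_one, div_one, RatFunc.algebraMap_X] at h
  rw [invertQ]
  refine h.trans ?_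
  simp [substInv]

/-- This is what matches evaluation at [-n] with the substitution t ↦ -qt of the bar involution. -/
theorem invertQ_qInt_neg (n : ℤ) : invertQ (qInt (-n)) = -q * qInt n := by
  have h1 := one_sub_q_ne_zero
  have h2 := q_ne_zero
  have h3 : (1 - q⁻¹ : RatFunc ℚ) ≠ 0 := by
    intro h
    apply h1
    have : (1 - q : RatFunc ℚ) = -q * (1 - q⁻¹) := by field_simp; ring
    rw [this, h, mul_zero]
  rw [qInt, qInt, map_div₀, map_sub, map_sub, map_zpow₀, map_one, invertQ_q, inv_zpow', neg_neg,
    div_eq_iff h3]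
  field_simp
  ring

theorem bar_eval (f : (RatFunc ℚ)[X]) (n : ℤ) :
    (bar f).eval (qInt n) = invertQ (f.eval (qInt (-n))) := by
  rw [bar, eval_comp, ← eval₂_hom, ← eval_map, invertQ_qInt_neg]
  simp

theorem q_mem_intPoly : q ∈ intPoly := Algebra.subset_adjoin rfl

theorem q_mem_intLaurent : q ∈ intLaurent := Algebra.subset_adjoin (Or.inl rfl)

theorem q_inv_mem_intLaurent : q⁻¹ ∈ intLaurent := Algebra.subset_adjoin (Or.inr rfl)

theorem qInt_natCast_mem_intPoly (m : ℕ) : qInt m ∈ intPoly := by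
  rw [qInt_natCast]
  exact sum_mem fun i _ => pow_mem q_mem_intPoly i

theorem q_zpow_mem_intLaurent (n : ℤ) : q ^ n ∈ intLaurent := by
  cases n with
  | ofNat n => simpa using pow_mem q_mem_intLaurent n
  | negSucc n =>
    rw [zpow_negSucc, ← inv_pow]
    exact pow_mem q_inv_mem_intLaurent _

theorem qInt_mem_intLaurent (n : ℤ) : qInt n ∈ intLaurent := by
  have hnat : ∀ m : ℕ, qInt m ∈ intLaurent := fun m => by
    rw [qInt_natCast]
    exact sum_mem fun i _ => pow_mem q_mem_intLaurent i
  obtain ⟨m, rfl | rfl⟩ := n.eq_nat_or_neg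
  · exact hnat m
  · have h1 : qInt (-(m : ℤ)) = -(q ^ (-(m : ℤ)) * qInt m) := by
      have h1 := one_sub_q_ne_zero
      have h2 := q_ne_zero
      rw [qInt, qInt, zpow_neg]
      field_simp
      ring
    rw [h1]
    exact neg_mem (mul_mem (q_zpow_mem_intLaurent _) (hnat m))

theorem delCon_mem {d : ℕ} {K S : Type} [CommSemiring K] [SetLike S K] [SubsemiringClass S K]
    (R : S) {s t : K}
    (hs : s ∈ R) (ht : t ∈ R) (L : List (Fin d → ℤ)) (E : Submodule ℝ (Fin d → ℝ)) :
    delCon s t (fun _ => 1) L E ∈ R := by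
  induction L generalizing E with
  | nil => exact one_mem R
  | cons a L ih =>
    by_cases h : E ≤ hyp a
    · rw [delCon_cons_of_le _ _ _ h]
      exact ih E
    · rw [delCon_cons_of_not_le _ _ _ h]
      exact add_mem (mul_mem hs (ih _)) (mul_mem ht (ih _))

/-! ### The graded Ehrhart polynomial -/

/-- The graded Ehrhart polynomial of the zonotope of a list of vectors. -/
def ehrhart {d : ℕ} (L : List (Fin d → ℤ)) (E : Submodule ℝ (Fin d → ℝ)) : (RatFunc ℚ)[X] :=
  delCon (1 - C (1 - q) * X) X (fun _ => 1) L E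

section

variable {d : ℕ} (L : List (Fin d → ℤ)) (E : Submodule ℝ (Fin d → ℝ))

theorem eval_ehrhart (x : RatFunc ℚ) :
    (ehrhart L E).eval x = delCon (1 - (1 - q) * x) x (fun _ => 1) L E := by
  rw [ehrhart, ← coe_evalRingHom, map_delCon]
  simp

theorem eval_ehrhart_qInt (n : ℤ) :
    (ehrhart L E).eval (qInt n) = delCon (q ^ n) (qInt n) (fun _ => 1) L E := by
  rw [eval_ehrhart, one_sub_mul_qInt]

theorem isPositiveQuantumIntegerValued_ehrhart :
    IsPositiveQuantumIntegerValued (ehrhart L E) := by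
  constructor
  · intro n
    rw [eval_ehrhart_qInt]
    exact delCon_mem _ (q_zpow_mem_intLaurent n) (qInt_mem_intLaurent n) _ _
  · intro n hn
    obtain ⟨m, rfl⟩ := Int.eq_ofNat_of_zero_le hn.le
    rw [eval_ehrhart_qInt, zpow_natCast]
    exact delCon_mem _ (pow_mem q_mem_intPoly m) (qInt_natCast_mem_intPoly m) _ _

/-- The embedding of `ℕ[q]` into `ℚ(q)`. -/
def toRatFunc : ℕ[X] →+* RatFunc ℚ :=
  (algebraMap ℚ[X] (RatFunc ℚ)).comp (mapRingHom (Nat.castRingHom ℚ))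

theorem toRatFunc_X : toRatFunc X = q := by
  simp [toRatFunc]

theorem eval_ehrhart_natCast (m : ℕ) : (ehrhart L E).eval (qInt m) =
    toRatFunc (graded false (L.flatMap (List.replicate m)) E) := by
  rw [graded_false, map_delCon, toRatFunc_X, map_one, delCon_flatMap_replicate, eval_ehrhart_qInt,
    zpow_natCast, qInt_natCast]

theorem invertQ_eval_ehrhart (m : ℕ)
    (hE : E ⊓ perp (L.flatMap (List.replicate m)) = ⊥) :
    (-1) ^ Module.finrank ℝ E * (q ^ Module.finrank ℝ E)⁻¹ *
      invertQ ((ehrhart L E).eval (qInt (-m))) =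
    toRatFunc (graded true (L.flatMap (List.replicate m)) E) := by
  rw [map_graded_true toRatFunc (by rw [toRatFunc_X]; exact q_ne_zero) _ _ hE, toRatFunc_X,
    delCon_flatMap_replicate, ← delCon_scale _ _ _ (neg_ne_zero.mpr q_ne_zero), eval_ehrhart_qInt,
    map_delCon, invertQ_qInt_neg, map_zpow₀, invertQ_q, inv_zpow', neg_neg, zpow_natCast,
    qInt_natCast, ← inv_pow, ← mul_pow, inv_neg, neg_one_mul, map_one]

theorem coe_toRatFunc (p : ℕ[X]) : ((toRatFunc p : RatFunc ℚ) : LaurentSeries ℚ) =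
    ((PowerSeries.mk fun k => (p.coeff k : ℚ) : PowerSeries ℚ) : LaurentSeries ℚ) := by
  have h1 := RatFunc.coe_coe (p.map (Nat.castRingHom ℚ))
  have h2 : ((p.map (Nat.castRingHom ℚ) : ℚ[X]) : PowerSeries ℚ) =
      PowerSeries.mk fun k => (p.coeff k : ℚ) := by
    ext k
    simp
  rw [h2] at h1
  exact h1.symm

-- Cancellation in the top coefficient is excluded by tracking its degree in q, which equals the
-- number of vectors not vanishing on E.
open Classical in
theorem natDegree_ehrhart :
    (ehrhart L E).natDegree = L.countP fun b => ¬ E ≤ hyp b := by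
  have key : ∀ (L : List (Fin d → ℤ)) (E : Submodule ℝ (Fin d → ℝ)),
      (ehrhart L E).natDegree ≤ L.countP (fun b => ¬ E ≤ hyp b) ∧
      ∃ p : ℚ[X], p.degree = (L.countP (fun b => ¬ E ≤ hyp b) : ℕ) ∧
        (ehrhart L E).coeff (L.countP fun b => ¬ E ≤ hyp b) = algebraMap _ _ p := by
    intro L
    induction L with
    | nil =>
      intro E
      refine ⟨by simp [ehrhart, delCon], 1, by simp, by simp [ehrhart, delCon]⟩
    | cons a L ih =>
      intro E
      by_cases h : E ≤ hyp a
      · rw [ehrhart, delCon_cons_of_le _ _ _ h, List.countP_cons_of_neg (by simpa using h)]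
        exact ih E
      · rw [ehrhart, delCon_cons_of_not_le _ _ _ h, List.countP_cons_of_pos (by simpa using h)]
        obtain ⟨h1, p, hp, hpc⟩ := ih E
        obtain ⟨h2, r, hr, hrc⟩ := ih (hyp a ⊓ E)
        have hle : L.countP (fun b => ¬ hyp a ⊓ E ≤ hyp b) ≤ L.countP (fun b => ¬ E ≤ hyp b) := by
          apply List.countP_mono_left
          intro b _ hb
          simp only [decide_eq_true_eq] at hb ⊢
          exact fun h => hb (inf_le_right.trans h)
        have h3 : (ehrhart L (hyp a ⊓ E)).coeff (L.countP fun b => ¬ E ≤ hyp b) =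
            algebraMap _ _ (if L.countP (fun b => ¬ hyp a ⊓ E ≤ hyp b) =
              L.countP (fun b => ¬ E ≤ hyp b) then r else 0) := by
          split_ifs with heq
          · rw [← heq, hrc]
          · rw [map_zero, coeff_eq_zero_of_natDegree_lt]
            omega
        rw [← ehrhart, ← ehrhart]
        generalize L.countP (fun b => ¬ E ≤ hyp b) = N at *
        generalize ehrhart L E = F at *
        generalize ehrhart L (hyp a ⊓ E) = G at *
        have hexp : (1 - C (1 - q) * X) * F + X * G =
            F + X * (C (q - 1) * F + G) := by
          rw [C_sub, C_sub]
          ring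
        rw [hexp]
        -- The new top coefficient is q - 1 times that of F, of q-degree N + 1, plus the coefficient
        -- of G at t^N. The latter has q-degree N, or is zero if contracting a makes further vectors
        -- vanish.
        refine ⟨?_, (X - 1) * p + (if L.countP (fun b => ¬ hyp a ⊓ E ≤ hyp b) = N then r else 0),
          ?_, ?_⟩
        · refine (natDegree_add_le _ _).trans (max_le (h1.trans (Nat.le_succ _)) ?_)
          refine natDegree_mul_le.trans ?_
          rw [natDegree_X, add_comm]
          gcongr
          exact (natDegree_add_le _ _).trans
            (max_le ((natDegree_C_mul_le _ _).trans h1) (h2.trans hle))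
        · have h4 : ((X - 1) * p : ℚ[X]).degree = ((N + 1 : ℕ) : WithBot ℕ) := by
            have : (X - 1 : ℚ[X]) = X - C 1 := by simp
            rw [degree_mul, hp, this, degree_X_sub_C, add_comm]
            rfl
          rw [degree_add_eq_left_of_degree_lt, h4]
          rw [h4]
          split_ifs with heq
          · rw [hr, heq]
            exact_mod_cast Nat.lt_succ_self N
          · rw [degree_zero]
            exact WithBot.bot_lt_coe _
        · rw [coeff_add, coeff_X_mul, coeff_add, coeff_C_mul, hpc, h3,
            coeff_eq_zero_of_natDegree_lt (Nat.lt_succ_of_le h1), zero_add, map_add, map_mul,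
            map_sub, map_one, RatFunc.algebraMap_X]
  obtain ⟨h1, p, hp, hpc⟩ := key L E
  refine le_antisymm h1 (le_natDegree_of_ne_zero ?_)
  rw [hpc]
  intro h0
  have : p = 0 := RatFunc.algebraMap_injective ℚ (by rw [h0, map_zero])
  rw [this, degree_zero] at hp
  exact WithBot.bot_ne_coe hp

end

end GradedEhrhart

end

noncomputable section

namespace GradedEhrhart

/-! ### Zonotopes as sums over lists -/

section

variable {d n : ℕ}

theorem zon_mono {T T' : Set ℝ} (h : T ⊆ T') (L : List (Fin d → ℤ)) : zon T L ⊆ zon T' L := by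
  induction L with
  | nil => exact subset_rfl
  | cons a L ih =>
    rintro _ ⟨t, ht, y, hy, rfl⟩
    exact ⟨t, h ht, y, ih hy, rfl⟩

/-- By convexity, m coefficients of the same vector may be replaced by m times their average. -/
theorem mem_zon_replicate {T : Set ℝ} (hT : Convex ℝ T) (hne : T.Nonempty) (a : Fin d → ℤ)
    (L : List (Fin d → ℤ)) (m : ℕ) (x : Fin d → ℝ) :
    x ∈ zon T (List.replicate m a ++ L) ↔
      ∃ s ∈ T, ∃ y ∈ zon T L, x = y + ((m : ℝ) * s) • intVec a := by
  induction m generalizing x with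
  | zero =>
    obtain ⟨s, hs⟩ := hne
    simp only [List.replicate_zero, List.nil_append, Nat.cast_zero, zero_mul, zero_smul, add_zero]
    exact ⟨fun h => ⟨s, hs, x, h, rfl⟩, by rintro ⟨_, _, y, hy, rfl⟩; exact hy⟩
  | succ m ih =>
    rw [List.replicate_succ, List.cons_append]
    have hm : (0 : ℝ) < (m : ℝ) + 1 := by positivity
    constructor
    · rintro ⟨t, ht, z, hz, rfl⟩
      obtain ⟨s, hs, y, hy, rfl⟩ := (ih z).mp hz
      refine ⟨(m / (m + 1) : ℝ) • s + (1 / (m + 1) : ℝ) • t, hT hs ht (by positivity)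
        (by positivity) (by field_simp), y, hy, ?_⟩
      rw [add_assoc, ← add_smul]
      congr 2
      push_cast
      simp only [smul_eq_mul]
      field_simp
    · rintro ⟨s, hs, y, hy, rfl⟩
      refine ⟨s, hs, _, (ih _).mpr ⟨s, hs, y, hy, rfl⟩, ?_⟩
      rw [add_assoc, ← add_smul]
      push_cast
      ring_nf

theorem zon_flatMap_replicate {T : Set ℝ} (hT : Convex ℝ T) (hne : T.Nonempty)
    (L : List (Fin d → ℤ)) (m : ℕ) :
    zon T (L.flatMap (List.replicate m)) = (m : ℝ) • zon T L := by
  induction L with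
  | nil => simp [zon]
  | cons a L ih =>
    ext x
    rw [List.flatMap_cons, mem_zon_replicate hT hne, ih, Set.mem_smul_set]
    constructor
    · rintro ⟨s, hs, _, ⟨y, hy, rfl⟩, rfl⟩
      exact ⟨_, ⟨s, hs, y, hy, rfl⟩, by simp only; module⟩
    · rintro ⟨_, ⟨s, hs, y, hy, rfl⟩, rfl⟩
      exact ⟨s, hs, _, Set.smul_mem_smul_set hy, by module⟩

theorem zon_ofFn (T : Set ℝ) (c : Fin n → Fin d → ℤ) :
    zon T (List.ofFn c) = {x | ∃ t : Fin n → ℝ, (∀ j, t j ∈ T) ∧ x = ∑ j, t j • intVec (c j)} := by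
  induction n with
  | zero =>
    ext x
    simp [zon]
  | succ n ih =>
    ext x
    rw [List.ofFn_succ]
    constructor
    · rintro ⟨s, hs, y, hy, rfl⟩
      rw [ih] at hy
      obtain ⟨t, ht, rfl⟩ := hy
      refine ⟨Fin.cons s t, fun j => ?_, ?_⟩
      · refine Fin.cases ?_ (fun j => ?_) j
        · simpa using hs
        · simpa using ht j
      · rw [Fin.sum_univ_succ, add_comm]
        simp
    · rintro ⟨t, ht, rfl⟩
      refine ⟨t 0, ht 0, ∑ j : Fin n, t j.succ • intVec (c j.succ), ?_, ?_⟩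
      · rw [ih]
        exact ⟨fun j => t j.succ, fun j => ht _, rfl⟩
      · rw [Fin.sum_univ_succ, add_comm]

/-- The list of columns of a matrix. -/
def cols (A : Matrix (Fin d) (Fin n) ℤ) : List (Fin d → ℤ) := List.ofFn A.col

theorem mulVec_map_intCast (A : Matrix (Fin d) (Fin n) ℤ) (t : Fin n → ℝ) :
    (A.map (Int.cast : ℤ → ℝ)).mulVec t = ∑ j, t j • intVec (A.col j) := by
  ext i
  simp [Matrix.mulVec, dotProduct, intVec, mul_comm]

theorem zon_cols (T : Set ℝ) (A : Matrix (Fin d) (Fin n) ℤ) :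
    zon T (cols A) = (A.map (Int.cast : ℤ → ℝ)).mulVec '' {t | ∀ j, t j ∈ T} := by
  rw [cols, zon_ofFn]
  ext x
  constructor
  · rintro ⟨t, ht, rfl⟩
    exact ⟨t, ht, mulVec_map_intCast A t⟩
  · rintro ⟨t, ht, rfl⟩
    exact ⟨t, ht, mulVec_map_intCast A t⟩

theorem zonotope_eq_zon (A : Matrix (Fin d) (Fin n) ℤ) :
    zonotope A = zon (Set.Icc 0 1) (cols A) := by
  rw [zon_cols, zonotope]
  congr 1
  ext t
  simp [Set.mem_Icc, Pi.le_def, forall_and]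

theorem mulVec_surjective {A : Matrix (Fin d) (Fin n) ℤ} (hA : IsUnimodular A) :
    Function.Surjective (A.map (Int.cast : ℤ → ℝ)).mulVecLin := by
  rw [← LinearMap.range_eq_top]
  apply Submodule.eq_top_of_finrank_eq
  rw [Module.finrank_fin_fun]
  exact hA.1

theorem perp_cols {A : Matrix (Fin d) (Fin n) ℤ} (hA : IsUnimodular A) : perp (cols A) = ⊥ := by
  rw [eq_bot_iff]
  intro η hη
  rw [Submodule.mem_bot]
  have h : ∀ x, form x η = 0 := by
    intro x
    obtain ⟨t, rfl⟩ := mulVec_surjective hA x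
    rw [Matrix.mulVecLin_apply, mulVec_map_intCast, map_sum, LinearMap.sum_apply]
    refine Finset.sum_eq_zero fun j _ => ?_
    rw [map_smul, LinearMap.smul_apply, mem_perp.mp hη (A.col j) (by simp [cols]), smul_zero]
  ext i
  have := h (Pi.single i 1)
  simpa [form_apply, Pi.single_apply] using this

theorem perp_flatMap_replicate {A : Matrix (Fin d) (Fin n) ℤ} (hA : IsUnimodular A) {m : ℕ}
    (hm : 1 ≤ m) : perp ((cols A).flatMap (List.replicate m)) = ⊥ := by
  rw [← perp_cols hA]
  ext η
  simp only [mem_perp, List.mem_flatMap, List.mem_replicate]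
  exact ⟨fun h a ha => h a ⟨a, ha, by omega, rfl⟩, by rintro h a ⟨b, hb, -, rfl⟩; exact h a hb⟩

theorem interior_zonotope {A : Matrix (Fin d) (Fin n) ℤ} (hA : IsUnimodular A) :
    interior (zonotope A) = zon (Set.Ioo 0 1) (cols A) := by
  apply Set.Subset.antisymm
  · intro x hx
    set f := (A.map (Int.cast : ℤ → ℝ)).mulVecLin with hf
    -- An interior point x can be pushed slightly away from the centre of the zonotope and stays
    -- inside. Averaging the coefficients found there with the constant 1/2 writes x with
    -- coefficients in the open interval.
    have hcont : ContinuousAt (fun ε : ℝ => x + ε • (x - f fun _ => 1 / 2)) 0 := by fun_prop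
    have h1 : ∀ᶠ ε : ℝ in nhds 0, x + ε • (x - f fun _ => 1 / 2) ∈ zonotope A :=
      hcont.eventually_mem (by simpa using mem_interior_iff_mem_nhds.mp hx)
    obtain ⟨ε, hε, hε0 : 0 < ε⟩ :=
      ((h1.filter_mono nhdsWithin_le_nhds).and (self_mem_nhdsWithin (s := Set.Ioi 0))).exists
    obtain ⟨u, hu, hux⟩ := hε
    rw [zon_cols]
    have hpos : (0 : ℝ) < 1 + ε := by positivity
    refine ⟨(1 + ε)⁻¹ • (u + ε • fun _ => 1 / 2), fun j => ?_, ?_⟩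
    · have hu0 := hu.1 j
      have hu1 := hu.2 j
      simp only [Pi.zero_apply, Pi.one_apply] at hu0 hu1
      simp only [Pi.smul_apply, Pi.add_apply, smul_eq_mul, Set.mem_Ioo]
      constructor
      · positivity
      · rw [inv_mul_lt_iff₀ hpos]
        linarith
    · change f _ = x
      have hux' : f u = x + ε • (x - f fun _ => 1 / 2) := hux
      rw [map_smul, map_add, hux', map_smul, inv_smul_eq_iff₀ hpos.ne']
      module
  · apply interior_maximal
    · rw [zonotope_eq_zon]
      exact zon_mono Set.Ioo_subset_Icc_self _
    · rw [zon_cols]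
      have hopen : IsOpenMap (A.map (Int.cast : ℤ → ℝ)).mulVecLin :=
        LinearMap.isOpenMap_of_finiteDimensional _ (mulVec_surjective hA)
      refine hopen _ ?_
      have : {t : Fin n → ℝ | ∀ j, t j ∈ Set.Ioo (0 : ℝ) 1} =
          Set.pi Set.univ fun _ => Set.Ioo (0 : ℝ) 1 := by
        ext t; simp
      rw [this]
      exact isOpen_set_pi Set.finite_univ fun _ _ => isOpen_Ioo

/-- The region whose lattice points are counted: a dilated zonotope, or its interior. -/
theorem zon_coeffSet_eq {A : Matrix (Fin d) (Fin n) ℤ} (m : ℕ) :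
    zon (coeffSet false) ((cols A).flatMap (List.replicate m)) = (m : ℝ) • zonotope A := by
  rw [zonotope_eq_zon]
  exact zon_flatMap_replicate (convex_Icc 0 1) ⟨0, by simp⟩ _ _

theorem zon_coeffSet_true_eq {A : Matrix (Fin d) (Fin n) ℤ} (hA : IsUnimodular A) {m : ℕ}
    (hm : 1 ≤ m) : zon (coeffSet true) ((cols A).flatMap (List.replicate m)) =
      interior ((m : ℝ) • zonotope A) := by
  rw [interior_smul₀ (by positivity), interior_zonotope hA]
  exact zon_flatMap_replicate (convex_Ioo 0 1) ⟨1 / 2, by norm_num⟩ _ _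

/-! ### Values of integer linear forms -/

/-- N and P count the entries pairing to -1 and to 1 with k. With open coefficients a single such
entry makes both bounds strict. -/
theorem exists_bounds_form {L : List (Fin d → ℤ)} {k : Fin d → ℤ}
    (hk : ∀ a ∈ L, a ⬝ᵥ k ∈ ({-1, 0, 1} : Set ℤ)) :
    ∃ N P : ℕ, N + P = width L (intVec k) ∧
      (∀ x ∈ zon (Set.Icc 0 1) L, -(N : ℝ) ≤ form x (intVec k) ∧ form x (intVec k) ≤ P) ∧
      (0 < width L (intVec k) → ∀ x ∈ zon (Set.Ioo 0 1) L,
        -(N : ℝ) < form x (intVec k) ∧ form x (intVec k) < P) := by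
  induction L with
  | nil =>
    refine ⟨0, 0, by simp [width], ?_, by simp [width]⟩
    rintro x rfl
    simp
  | cons a L ih =>
    obtain ⟨N, P, hNP, hIcc, hIoo⟩ := ih fun b hb => hk b (List.mem_cons_of_mem _ hb)
    have hval := form_intVec a k
    have hsub : ∀ x ∈ zon (Set.Ioo 0 1) L, -(N : ℝ) ≤ form x (intVec k) ∧
        form x (intVec k) ≤ P := fun x hx => hIcc x (zon_mono Set.Ioo_subset_Icc_self L hx)
    rcases hk a List.mem_cons_self with h | h | h
    · rw [h] at hval
      rw [width_cons_of_ne (by rw [hval]; norm_num)]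
      refine ⟨N + 1, P, by omega, ?_, fun _ => ?_⟩
      · rintro _ ⟨t, ht, y, hy, rfl⟩
        have := hIcc y hy
        simp only [map_add, map_smul, LinearMap.add_apply, LinearMap.smul_apply, hval, smul_eq_mul]
        push_cast
        constructor <;> linarith [ht.1, ht.2]
      · rintro _ ⟨t, ht, y, hy, rfl⟩
        have := hsub y hy
        simp only [map_add, map_smul, LinearMap.add_apply, LinearMap.smul_apply, hval, smul_eq_mul]
        push_cast
        constructor <;> linarith [ht.1, ht.2]
    · rw [h, Int.cast_zero] at hval
      rw [width_cons_of_eq hval]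
      refine ⟨N, P, hNP, ?_, fun hw => ?_⟩
      · rintro _ ⟨t, ht, y, hy, rfl⟩
        simpa [hval] using hIcc y hy
      · rintro _ ⟨t, ht, y, hy, rfl⟩
        simpa [hval] using hIoo hw y hy
    · rw [h] at hval
      rw [width_cons_of_ne (by rw [hval]; norm_num)]
      refine ⟨N, P + 1, by omega, ?_, fun _ => ?_⟩
      · rintro _ ⟨t, ht, y, hy, rfl⟩
        have := hIcc y hy
        simp only [map_add, map_smul, LinearMap.add_apply, LinearMap.smul_apply, hval, smul_eq_mul]
        push_cast
        constructor <;> linarith [ht.1, ht.2]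
      · rintro _ ⟨t, ht, y, hy, rfl⟩
        have := hsub y hy
        simp only [map_add, map_smul, LinearMap.add_apply, LinearMap.smul_apply, hval, smul_eq_mul]
        push_cast
        constructor <;> linarith [ht.1, ht.2]

theorem sum_intVec_mul_intCast (k z : Fin d → ℤ) :
    ∑ i, ((intVec k i : ℝ) : ℂ) * (z i : ℂ) = ((z ⬝ᵥ k : ℤ) : ℂ) := by
  simp [intVec, dotProduct, mul_comm]

/-- The bound on the number of values of an integer linear form of given width. -/
def valueBound (b : Bool) (w : ℕ) : ℕ := if b then w - 1 else w + 1

theorem linPoly_pow_valueBound_mem_gr {L : List (Fin d → ℤ)} {k : Fin d → ℤ} (b : Bool)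
    (hk : ∀ a ∈ L, a ⬝ᵥ k ∈ ({-1, 0, 1} : Set ℤ)) (hw : b = true → 0 < width L (intVec k)) :
    linPoly (intVec k) ^ valueBound b (width L (intVec k)) ∈
      gr (MvPolynomial.vanishingIdeal ℂ (latticePoints (zon (coeffSet b) L))) := by
  obtain ⟨N, P, hNP, hIcc, hIoo⟩ := exists_bounds_form hk
  have key : ∀ S : Finset ℤ, (∀ z : Fin d → ℤ, intVec z ∈ zon (coeffSet b) L → z ⬝ᵥ k ∈ S) →
      linPoly (intVec k) ^ S.card ∈
        gr (MvPolynomial.vanishingIdeal ℂ (latticePoints (zon (coeffSet b) L))) := by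
    intro S hS
    rw [← Finset.card_image_of_injective S (Int.cast_injective (α := ℂ))]
    apply linPoly_pow_mem_gr
    rintro _ ⟨z, hz, rfl⟩
    rw [sum_intVec_mul_intCast]
    exact Finset.mem_image_of_mem _ (hS z hz)
  cases b with
  | false =>
    have h := key (Finset.Icc (-(N : ℤ)) P) (fun z hz => by
      have h1 := hIcc _ hz
      rw [form_intVec] at h1
      rw [Finset.mem_Icc]
      exact ⟨by exact_mod_cast h1.1, by exact_mod_cast h1.2⟩)
    have hcard : (Finset.Icc (-(N : ℤ)) P).card = valueBound false (width L (intVec k)) := by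
      rw [Int.card_Icc, ← hNP]
      simp only [valueBound, Bool.false_eq_true, if_false]
      omega
    rwa [hcard] at h
  | true =>
    have h := key (Finset.Ioo (-(N : ℤ)) P) (fun z hz => by
      have h1 := hIoo (hw rfl) _ hz
      rw [form_intVec] at h1
      rw [Finset.mem_Ioo]
      exact ⟨by exact_mod_cast h1.1, by exact_mod_cast h1.2⟩)
    have hcard : (Finset.Ioo (-(N : ℤ)) P).card = valueBound true (width L (intVec k)) := by
      rw [Int.card_Ioo, ← hNP]
      simp only [valueBound, if_true]
      omega
    rwa [hcard] at h

/-! ### The graded count -/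

theorem encard_points_le (T : Set ℝ) (L : List (Fin d → ℤ)) :
    (points T L ⊤).encard ≤ (latticePoints (zon T L)).encard := by
  have hinj : Function.Injective (fun (z : Fin d → ℤ) (i : Fin d) => (z i : ℂ)) := by
    intro z w h
    ext i
    exact Int.cast_injective (congrFun h i)
  rw [latticePoints, hinj.encard_image]
  have hsub : points T L ⊤ ⊆ (fun z => res ⊤ (intVec z)) '' {z | intVec z ∈ zon T L} := by
    rintro φ ⟨⟨z, rfl⟩, x, hx, hzx⟩
    have : intVec z = x := by
      ext i
      have := LinearMap.congr_fun hzx ⟨Pi.single i 1, trivial⟩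
      simpa [res_apply, form_apply, Pi.single_apply] using this
    exact ⟨z, by rw [Set.mem_ofPred_eq, this]; exact hx, rfl⟩
  exact (Set.encard_le_encard hsub).trans (Set.encard_image_le _ _)

/-- Termwise upper bounds whose sum p(1) is at most the number of points, hence at most the total
dimension, must all be attained. -/
theorem finrank_orbPiece_eq {𝒵 : Set (Fin d → ℂ)} {p : Polynomial ℕ}
    (hle : ∀ k, Module.finrank ℂ (orbPiece 𝒵 k) ≤ p.coeff k)
    (hcard : ((p.eval 1 : ℕ) : ℕ∞) ≤ 𝒵.encard) (k : ℕ) :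
    Module.finrank ℂ (orbPiece 𝒵 k) = p.coeff k := by
  obtain ⟨Z, hZ, hZcard⟩ := Set.exists_subset_encard_eq hcard
  have hfin : Z.Finite := Set.finite_of_encard_eq_coe hZcard
  have hcoeff : ∀ k, p.natDegree + 1 ≤ k → p.coeff k = 0 := fun k hk =>
    Polynomial.coeff_eq_zero_of_natDegree_lt hk
  have h1 := card_le_sum_finrank_orbPiece (Z := hfin.toFinset) (by simpa using hZ)
    (M := p.natDegree + 1) (fun k hk => Nat.le_zero.mp ((hle k).trans_eq (hcoeff k hk)))
  rw [hfin.encard_eq_coe_toFinset_card] at hZcard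
  rw [Nat.cast_inj.mp hZcard, Polynomial.eval_eq_sum_range] at h1
  simp only [one_pow, mul_one] at h1
  have h2 := (Finset.sum_eq_sum_iff_of_le fun k _ => hle k).mp
    (le_antisymm (Finset.sum_le_sum fun k _ => hle k) h1)
  by_cases hk : k < p.natDegree + 1
  · exact h2 k (Finset.mem_range.mpr hk)
  · have h3 := hcoeff k (not_lt.mp hk)
    have h4 := hle k
    omega

theorem hilbOrb_zon {A : Matrix (Fin d) (Fin n) ℤ} (hA : IsUnimodular A) (b : Bool) (m : ℕ)
    (hm : b = true → 1 ≤ m) :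
    hilbOrb (latticePoints (zon (coeffSet b) ((cols A).flatMap (List.replicate m)))) =
      PowerSeries.mk fun k =>
        (((graded b ((cols A).flatMap (List.replicate m)) ⊤).coeff k : ℕ) : ℚ) := by
  set L := (cols A).flatMap (List.replicate m) with hL
  have hcol : ∀ a ∈ L, a ∈ Set.range A.col := by
    intro a ha
    rw [hL, List.mem_flatMap] at ha
    obtain ⟨c, hc, ha⟩ := ha
    rw [List.eq_of_mem_replicate ha]
    rwa [cols, List.mem_ofFn] at hc
  have hrel : ∀ η ∈ testDirs A, η ≠ 0 → linPoly η ^ valueBound b (width L η) ∈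
      gr (MvPolynomial.vanishingIdeal ℂ (latticePoints (zon (coeffSet b) L))) := by
    rintro _ ⟨k, rfl, hk⟩ h0
    apply linPoly_pow_valueBound_mem_gr
    · intro a ha
      obtain ⟨j, rfl⟩ := hcol a ha
      exact hk j
    -- A direction of width 0 is orthogonal to every column, hence zero by full rank; here m ≥ 1 is
    -- needed so that each column occurs.
    · intro hb
      rw [Nat.pos_iff_ne_zero]
      intro hw
      apply h0
      have h1 : intVec k ∈ perp L := by
        rw [mem_perp]
        simpa [width] using hw
      rwa [perp_flatMap_replicate hA (hm hb), Submodule.mem_bot] at h1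
  have hupper : ∀ k, Module.finrank ℂ (orbPiece (latticePoints (zon (coeffSet b) L)) k) ≤
      (graded b L ⊤).coeff k := by
    intro k
    refine (finrank_orbPiece_le hrel k).trans ?_
    -- The bounds are w + 1 and the truncated w - 1. The latter is 0 at both w = 0 and w = 1, as the
    -- coloop case requires.
    refine finrank_boundedFun_le (S := Set.range A.col) ?_ ?_ ?_ ?_ hcol [] (by simp)
    · cases b <;> simp [valueBound]
    · intro w
      cases b <;> simp [valueBound]
      omega
    · rintro rfl
      simp [valueBound]
    · intro C hC
      exact perp_le_span_testDirs hA C fun c hc => by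
        obtain ⟨j, hj⟩ := hC c hc
        exact ⟨j, hj.symm⟩
  have hlower : (((graded b L ⊤).eval 1 : ℕ) : ℕ∞) ≤
      (latticePoints (zon (coeffSet b) L)).encard :=
    (eval_graded_le_encard_points b).trans (encard_points_le _ _)
  rw [hilbOrb]
  congr 1
  funext k
  rw [finrank_orbPiece_eq hupper hlower]

open Classical in
theorem natDegree_ehrhart_cols (A : Matrix (Fin d) (Fin n) ℤ) :
    (ehrhart (cols A) ⊤).natDegree = (Finset.univ.filter fun j : Fin n => A.col j ≠ 0).card := by
  have htop : ∀ a : Fin d → ℤ, (⊤ : Submodule ℝ (Fin d → ℝ)) ≤ hyp a ↔ a = 0 := by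
    intro a
    constructor
    · intro h
      ext i
      have := mem_hyp.mp (h (Submodule.mem_top (x := Pi.single i 1)))
      simpa [form_apply, Pi.single_apply, intVec] using this
    · rintro rfl y -
      simp [mem_hyp, form_apply, intVec]
  rw [natDegree_ehrhart, cols, List.ofFn_eq_map, List.countP_map, List.countP_eq_length_filter]
  simp only [Function.comp_def, htop]
  rfl

end

end GradedEhrhart

end

/-- Equalities between graded lattice point counts and elements of `ℚ(q)` are equalities in the
field `ℚ((q))` of formal Laurent series, which contains both `ℚ⟦q⟧` and `ℚ(q)`. -/
theorem mainTheorem7 (d n : ℕ) (A : Matrix (Fin d) (Fin n) ℤ)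
    (hA : GradedEhrhart.IsUnimodular A) :
    ∃ ehr : Polynomial (RatFunc ℚ),
      GradedEhrhart.IsPositiveQuantumIntegerValued ehr ∧
      ehr.natDegree = (Finset.univ.filter fun j : Fin n => A.col j ≠ 0).card ∧
      (∀ m : ℕ,
        ((ehr.eval (GradedEhrhart.qInt m) : RatFunc ℚ) : LaurentSeries ℚ) =
          (GradedEhrhart.latticeCount (GradedEhrhart.zonotope A) m : LaurentSeries ℚ)) ∧
      ∀ m : ℕ, 1 ≤ m →
        (-1) ^ d * (GradedEhrhart.q ^ d)⁻¹ *
              (GradedEhrhart.bar ehr).eval (GradedEhrhart.qInt m) =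
            (-1) ^ d * (GradedEhrhart.q ^ d)⁻¹ *
              GradedEhrhart.invertQ (ehr.eval (GradedEhrhart.qInt (-m))) ∧
          (((-1) ^ d * (GradedEhrhart.q ^ d)⁻¹ *
              GradedEhrhart.invertQ (ehr.eval (GradedEhrhart.qInt (-m))) : RatFunc ℚ) :
                LaurentSeries ℚ) =
            (GradedEhrhart.interiorLatticeCount (GradedEhrhart.zonotope A) m :
              LaurentSeries ℚ) := by
  open GradedEhrhart in
  refine ⟨ehrhart (cols A) ⊤, isPositiveQuantumIntegerValued_ehrhart _ _, ?_, fun m => ?_,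
    fun m hm => ⟨?_, ?_⟩⟩
  · rw [natDegree_ehrhart_cols]
  · rw [eval_ehrhart_natCast, coe_toRatFunc, latticeCount, ← zon_coeffSet_eq,
      hilbOrb_zon hA false m (by simp)]
  · rw [bar_eval]
  · have h := invertQ_eval_ehrhart (cols A) ⊤ m (by rw [perp_flatMap_replicate hA hm, inf_bot_eq])
    rw [finrank_top, Module.finrank_fin_fun] at h
    rw [h, coe_toRatFunc, interiorLatticeCount, ← zon_coeffSet_true_eq hA hm,
      hilbOrb_zon hA true m (fun _ => hm)]
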